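/- Let $M$ be an $m\times n$ binary matrix. For $0\le k\le p\le n$, $M$ is a $(p,k,n)$-selector if for every set $S$ of $p$ columns, the submatrix of $M$ formed by the columns in $S$ contains at least $k$ distinct rows of the $p\times p$ identity matrix. For $1\le p\le n$ and $\mathbf v=(v_1,\dots,v_p)$ with integers $0\le v_i\le i$, $M$ is a $(p,\mathbf v,n)$-superselector of size $m$ if it is an $(i,v_i,n)$-selector for every $i=1,\dots,p$. Theorem. There are absolute constants $K$ and $C$ and a deterministic random access machine program (unit-cost steps; arithmetic instructions: addition and truncated subtraction) such that, for all integers $n\ge 2$, $1\le p\le n$ and all integers $0\le v_i\le i$ ($i=1,\dots,p$), the program, on input $n$, $p$, $\mathbf v=(v_1,\dots,v_p)$, halts after at most $C^{p}\,n^{p+C}$ steps (thus in time polynomial in $n$ and exponential in $p$) and outputs a $(p,\mathbf v,n)$-superselector of size $$m\le K\max_{j=1,\dots,p} k_j\log\frac nj,\qquad\text{where } k_j=\min\left\{\frac{3pej}{j-v_j+1},\ \frac{ej^2}{\log_2 e}\right\}.$$ In particular, such a superselector exists. -/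

import Mathlib

/-! ## Selectors and superselectors -/

open Classical in
/-- An `m × n` binary matrix `M` is a `(p, k, n)`-selector if, for every set `S` of `p` columns,
the submatrix formed by the columns in `S` contains at least `k` (distinct) rows of the `p × p`
identity matrix.  The row of the identity matrix with its `1` in column `s ∈ S` is the
indicator of `s` on `S`. -/
def IsSelector {m n : ℕ} (p k : ℕ) (M : Matrix (Fin m) (Fin n) Bool) : Prop :=
  ∀ S : Finset (Fin n), S.card = p →
    k ≤ (S.filter fun s => ∃ r : Fin m, ∀ t ∈ S, M r t = decide (t = s)).card

/-- `M` is a `(p, v, n)`-superselector: it is an `(i, v i, n)`-selector for `i = 1, …, p`.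
Only the entries `v 1, …, v p` of `v` matter. -/
def IsSuperselector {m n : ℕ} (p : ℕ) (v : ℕ → ℕ) (M : Matrix (Fin m) (Fin n) Bool) : Prop :=
  ∀ i : ℕ, 1 ≤ i → i ≤ p → IsSelector i (v i) M

/-- `k_j = min {3 p e j / (j - v_j + 1), e j² / log₂ e}`. -/
noncomputable def superK (p : ℕ) (v : ℕ → ℕ) (j : ℕ) : ℝ :=
  min (3 * (p : ℝ) * Real.exp 1 * (j : ℝ) / ((j : ℝ) - (v j : ℝ) + 1))
    (Real.exp 1 * (j : ℝ) ^ 2 / Real.logb 2 (Real.exp 1))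

/-- `max_{j = 1, …, p} k_j log (n / j)`. -/
noncomputable def superBound (n p : ℕ) (v : ℕ → ℕ) (hp : 1 ≤ p) : ℝ :=
  (Finset.Icc 1 p).sup' (Finset.nonempty_Icc.2 hp)
    fun j => superK p v j * Real.log ((n : ℝ) / (j : ℝ))

/-! ## Random access machine programs, with a step count

The machine has registers and arrays that hold natural numbers; a program mentions only finitely
many of each, by fixed names.  Every instruction takes one step.  The arithmetic
instructions are addition and truncated subtraction; in particular there is no multiplication
in one step, so step counts are polynomially related to those of Turing machines. -/

namespace RAM

/-- A memory state: the contents of the registers and of the arrays. -/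
@[ext] structure State where
  reg : ℕ → ℕ
  arr : ℕ → ℕ → ℕ

/-- Write `a` into register `x`. -/
def State.setReg (s : State) (x a : ℕ) : State :=
  { s with reg := Function.update s.reg x a }

/-- Write `a` into cell `i` of array `b`. -/
def State.setArr (s : State) (b i a : ℕ) : State :=
  { s with arr := Function.update s.arr b (Function.update (s.arr b) i a) }

/-- Programs. -/
inductive Prog where
  /-- do nothing -/
  | skip : Prog
  /-- `x := a`, for a fixed number `a` -/
  | const (x a : ℕ) : Prog
  /-- `x := y + z`, for registers `x`, `y`, `z` -/
  | add (x y z : ℕ) : Prog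
  /-- `x := y - z` (zero if `y < z`), for registers `x`, `y`, `z` -/
  | sub (x y z : ℕ) : Prog
  /-- `x := b[y]`, for registers `x`, `y` and an array `b` -/
  | load (x b y : ℕ) : Prog
  /-- `b[x] := y`, for registers `x`, `y` and an array `b` -/
  | store (b x y : ℕ) : Prog
  /-- first the one, then the other -/
  | seq (c d : Prog) : Prog
  /-- if register `x` is nonzero then `c` else `d` -/
  | branch (x : ℕ) (c d : Prog) : Prog
  /-- while register `x` is nonzero do `c` -/
  | loop (x : ℕ) (c : Prog) : Prog

/-- `Exec c s t k`: the program `c`, started in state `s`, halts in state `t` after `k` steps. -/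
inductive Exec : Prog → State → State → ℕ → Prop where
  | skip (s : State) : Exec .skip s s 1
  | const (s : State) (x a : ℕ) : Exec (.const x a) s (s.setReg x a) 1
  | add (s : State) (x y z : ℕ) : Exec (.add x y z) s (s.setReg x (s.reg y + s.reg z)) 1
  | sub (s : State) (x y z : ℕ) : Exec (.sub x y z) s (s.setReg x (s.reg y - s.reg z)) 1
  | load (s : State) (x b y : ℕ) : Exec (.load x b y) s (s.setReg x (s.arr b (s.reg y))) 1
  | store (s : State) (b x y : ℕ) : Exec (.store b x y) s (s.setArr b (s.reg x) (s.reg y)) 1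
  | seq {c d : Prog} {s t u : State} {k l : ℕ} :
      Exec c s t k → Exec d t u l → Exec (.seq c d) s u (k + l)
  | branch_pos {x : ℕ} {c d : Prog} {s t : State} {k : ℕ} :
      s.reg x ≠ 0 → Exec c s t k → Exec (.branch x c d) s t (k + 1)
  | branch_zero {x : ℕ} {c d : Prog} {s t : State} {k : ℕ} :
      s.reg x = 0 → Exec d s t k → Exec (.branch x c d) s t (k + 1)
  | loop_zero {x : ℕ} {c : Prog} {s : State} :
      s.reg x = 0 → Exec (.loop x c) s s 1
  | loop_pos {x : ℕ} {c : Prog} {s t u : State} {k l : ℕ} :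
      s.reg x ≠ 0 → Exec c s t k → Exec (.loop x c) t u l → Exec (.loop x c) s u (k + l + 1)

/-- Programs are deterministic: the final state and the number of steps are determined by the
program and the initial state. -/
theorem Exec.deterministic {c : Prog} {s t t' : State} {k k' : ℕ}
    (h : Exec c s t k) (h' : Exec c s t' k') : t = t' ∧ k = k' := by
  induction h generalizing t' k' with
  | skip | const | add | sub | load | store => cases h'; exact ⟨rfl, rfl⟩
  | seq _ _ ih₁ ih₂ =>
    cases h' with
    | seq a b => obtain ⟨rfl, rfl⟩ := ih₁ a; obtain ⟨rfl, rfl⟩ := ih₂ b; exact ⟨rfl, rfl⟩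
  | branch_pos hx _ ih =>
    cases h' with
    | branch_pos _ a => obtain ⟨rfl, rfl⟩ := ih a; exact ⟨rfl, rfl⟩
    | branch_zero hx' _ => exact absurd hx' hx
  | branch_zero hx _ ih =>
    cases h' with
    | branch_pos hx' _ => exact absurd hx hx'
    | branch_zero _ a => obtain ⟨rfl, rfl⟩ := ih a; exact ⟨rfl, rfl⟩
  | loop_zero hx =>
    cases h' with
    | loop_zero _ => exact ⟨rfl, rfl⟩
    | loop_pos hx' _ _ => exact absurd hx hx'
  | loop_pos hx _ _ ih₁ ih₂ =>
    cases h' with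
    | loop_zero hx' => exact absurd hx' hx
    | loop_pos _ a b => obtain ⟨rfl, rfl⟩ := ih₁ a; obtain ⟨rfl, rfl⟩ := ih₂ b; exact ⟨rfl, rfl⟩

/-- The initial state on input `n`, `p`, `(v 1, …, v p)`: array `0` holds
`n, p, v 1, …, v p, 0, 0, …`, and everything else is zero. -/
def input (n p : ℕ) (v : ℕ → ℕ) : State where
  reg := fun _ => 0
  arr := fun b i =>
    if b = 0 then
      if i = 0 then n else if i = 1 then p else if i ≤ p + 1 then v (i - 1) else 0
    else 0

/-- The state `t` presents the matrix `M` as output: array `1` starts with the number `m` of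
rows, followed by the `m * n` entries of `M`, row by row. -/
def Outputs {m n : ℕ} (t : State) (M : Matrix (Fin m) (Fin n) Bool) : Prop :=
  t.arr 1 0 = m ∧
    ∀ (r : Fin m) (c : Fin n), t.arr 1 (1 + (r : ℕ) * n + (c : ℕ)) = if M r c then 1 else 0

end RAM

/-!
The rows are chosen greedily from a small explicit pool of rows, by the method of conditional
expectations, and the program carries this out.

**Events.** For `j ≤ p` let `T_j = j - v_j + 1` (`threshold`). If `|S| = j` and fewer than `v_j`
rows of the identity matrix occur on `S`, then some set `T ⊆ S` of `T_j` columns is missed: no row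
has exactly one entry `1` on `S` with this entry in `T`. So it suffices that each of the at most
`2 ^ j * n.choose j` pairs `(S, T)` is hit by some row (`isSuperselector_of_hit`).

**Pool.** For a prime `Q` with `n < Q ≤ 2 n` and `B = ⌊Q / (2 d)⌋`, the `Q ^ 2` rows
`x ↦ [(a x + b) mod Q < B]` are pairwise independent, and so hit each event with `|S| ≤ d` with
frequency at least `|T| / (8 d)` (`card_hit_ge`). The program never tests primality: it goes
through all `Q, B, a, b ≤ 2 n`, since a minimum over a larger pool can only be smaller.

**Two densities.** Let `g` be the largest `j ≤ p` with `j T_j ≤ 2 p`. The bound `k_j` is, up to a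
constant factor, `p j / T_j` for `j > g`, and `k_g` is of order `g ^ 2`. Mixing the pools for
`d = p` and `d = g` in equal parts hits an event with `|S| = j` with frequency at least
`T_j / (16 D_j)`, where `D_j = g` for `j ≤ g` and `D_j = p` otherwise. With
`m ≥ 80 (D_j j / T_j) log (n / j)` rows, the expected number of events with `|S| = j` that are
never hit is at most `2 ^ (-j)` (`weight_le`), hence the total is less than `1`. As
`j log (n / j) ≤ 3 g log (n / g)` for `j ≤ g`, such an `m` is within the bound (`exists_size`).

**Derandomization.** In integers: with `Y = 16 p g` and `X_j = Y (1 - T_j / (16 D_j))`, the program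
looks for the least `m` with `∑ X_j ^ m < Y ^ m`, the sum being over these events, and then chooses
`m` rows one by one, each minimizing the total weight of the events that survive, where an event has
weight `X_j ^ r` if `r` rows remain to be chosen. Each choice divides the total by `Y` at least
(`exists_good_row`), so that it ends below `1`, that is, at `0`.

All this requires `2 p ≤ n`, which makes `log (e n / j)` comparable with `log (n / j)`. If
`2 p > n`, the identity matrix will do (`card_le_superBound`).

**Program.** The events are listed by extending events already listed by one more column, so
that the number of entries `1` of a row on `S` and on `T` is obtained from a shorter event in constant
time. Programs are verified with triples `Reach c s T Q` (total correctness within `T` steps). What a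
part of the program leaves unchanged is read off from its text (`Exec.agree`, with the lists of
written registers and arrays evaluated by `decide`).
-/

open Finset

/-! ### Events -/

/-- An event: a set `S` of columns and a set `T ⊆ S`.  A row hits the event if it has exactly one
entry `1` on `S`, and that in a column of `T`. -/
abbrev Event := Finset ℕ × Finset ℕ

/-- The row `R` (a `0`-`1`-valued function) hits the event `e`. -/
def Hit (R : ℕ → ℕ) (e : Event) : Prop := ∑ x ∈ e.1, R x = 1 ∧ ∑ x ∈ e.2, R x = 1

instance (R : ℕ → ℕ) (e : Event) : Decidable (Hit R e) := inferInstanceAs (Decidable (_ ∧ _))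

theorem Hit.congr {R R' : ℕ → ℕ} {e : Event} {n : ℕ} (h1 : e.1 ⊆ range n) (h2 : e.2 ⊆ e.1)
    (h : ∀ x < n, R x = R' x) : Hit R e ↔ Hit R' e := by
  unfold Hit
  rw [sum_congr rfl fun x hx => h x (mem_range.1 (h1 hx)),
    sum_congr rfl fun x hx => h x (mem_range.1 (h1 (h2 hx)))]

/-- The extensions of an event by a new column `x`, as long as at most `p` columns are used. -/
def extensions (p x : ℕ) (e : Event) : List Event :=
  if e.1.card < p then [(insert x e.1, e.2), (insert x e.1, insert x e.2)] else []

/-- The list of all events `(S, T)` with `S ⊆ {0, …, x - 1}` and `|S| ≤ p`. -/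
def eventList (p : ℕ) : ℕ → List Event
  | 0 => [(∅, ∅)]
  | x + 1 => eventList p x ++ (eventList p x).flatMap (extensions p x)

theorem mem_eventList {p n : ℕ} {e : Event} (h : e ∈ eventList p n) :
    e.2 ⊆ e.1 ∧ e.1 ⊆ range n ∧ e.1.card ≤ p := by
  induction n generalizing e with
  | zero => simp only [eventList, List.mem_singleton] at h; subst h; simp
  | succ x ih =>
    have hr : range x ⊆ range (x + 1) := range_mono (Nat.le_succ x)
    rw [eventList, List.mem_append, List.mem_flatMap] at h
    obtain h | ⟨f, hf, h⟩ := h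
    · exact ⟨(ih h).1, (ih h).2.1.trans hr, (ih h).2.2⟩
    · obtain ⟨h1, h2, -⟩ := ih hf
      have hins : insert x f.1 ⊆ range (x + 1) := insert_subset (by simp) (h2.trans hr)
      have hc := card_insert_le x f.1
      unfold extensions at h
      split_ifs at h with hp
      · simp only [List.mem_cons, List.not_mem_nil, or_false] at h
        obtain rfl | rfl := h
        · exact ⟨h1.trans (subset_insert _ _), hins, by simp only; omega⟩
        · exact ⟨insert_subset_insert _ h1, hins, by simp only; omega⟩
      · simp at h

theorem mem_eventList_of_subset {p n : ℕ} {S T : Finset ℕ} (hT : T ⊆ S) (hS : S ⊆ range n)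
    (hp : S.card ≤ p) : (S, T) ∈ eventList p n := by
  induction n generalizing S T with
  | zero =>
    obtain rfl : S = ∅ := by simpa using hS
    obtain rfl : T = ∅ := by simpa using hT
    simp [eventList]
  | succ x ih =>
    rw [eventList, List.mem_append, List.mem_flatMap]
    have hS' : S.erase x ⊆ range x := by
      intro y hy
      rw [mem_erase] at hy
      have := mem_range.1 (hS hy.2)
      rw [mem_range]; omega
    by_cases hx : x ∈ S
    · right
      have hc := card_erase_add_one hx
      refine ⟨(S.erase x, T.erase x), ih (erase_subset_erase _ hT) hS' (by omega), ?_⟩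
      rw [extensions, if_pos (show (S.erase x).card < p by omega)]
      by_cases hxT : x ∈ T
      · simp [insert_erase hx, insert_erase hxT]
      · simp [insert_erase hx, erase_eq_of_notMem hxT]
    · left
      rw [erase_eq_of_notMem hx] at hS'
      exact ih hT hS' hp

/-- The number of events with `|S| = j` is `2 ^ j * n.choose j`. -/
theorem sum_map_eventList (p n : ℕ) (f : ℕ → ℕ) :
    ((eventList p n).map fun e => f e.1.card).sum =
      ∑ j ∈ range (p + 1), n.choose j * 2 ^ j * f j := by
  induction n generalizing f with
  | zero => simp [eventList, sum_range_succ', Nat.choose_zero_succ]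
  | succ x ih =>
    have key : ((eventList p x).flatMap (extensions p x)).map (fun e => f e.1.card) =
        (eventList p x).flatMap fun e =>
          if e.1.card < p then [f (e.1.card + 1), f (e.1.card + 1)] else [] := by
      rw [List.map_flatMap]
      refine List.flatMap_congr fun e he => ?_
      have hx : x ∉ e.1 := fun h => by simpa using (mem_eventList he).2.1 h
      unfold extensions
      split_ifs <;> simp [card_insert_of_notMem hx]
    have key2 : ((eventList p x).flatMap fun e =>
          if e.1.card < p then [f (e.1.card + 1), f (e.1.card + 1)] else []).sum =
        ((eventList p x).map fun e =>
          (fun j => if j < p then 2 * f (j + 1) else 0) e.1.card).sum := by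
      induction eventList p x with
      | nil => rfl
      | cons a l ihl =>
        rw [List.flatMap_cons, List.sum_append, ihl, List.map_cons, List.sum_cons]
        split_ifs <;> simp [two_mul, *]
    rw [eventList, List.map_append, List.sum_append, key, key2, ih f,
      ih fun j => if j < p then 2 * f (j + 1) else 0,
      sum_range_succ (fun j => x.choose j * 2 ^ j * if j < p then 2 * f (j + 1) else 0),
      sum_range_succ' (fun j => (x + 1).choose j * 2 ^ j * f j),
      sum_range_succ' (fun j => x.choose j * 2 ^ j * f j)]
    have : ∀ j ∈ range p, x.choose j * 2 ^ j * (if j < p then 2 * f (j + 1) else 0) =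
        x.choose j * 2 ^ (j + 1) * f (j + 1) := by
      intro j hj
      rw [if_pos (mem_range.1 hj)]; ring
    rw [sum_congr rfl this]
    simp only [Nat.choose_succ_succ, Nat.choose_zero_right, lt_irrefl, if_false, mul_zero,
      add_zero, add_mul, sum_add_distrib]
    ring

theorem length_eventList_le (p : ℕ) {n : ℕ} (hn : 1 ≤ n) :
    (eventList p n).length ≤ 4 ^ p * n ^ p := by
  have h := sum_map_eventList p n fun _ => 1
  simp only [List.map_const', List.sum_replicate, smul_eq_mul, mul_one] at h
  rw [h]
  calc ∑ j ∈ range (p + 1), n.choose j * 2 ^ j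
      ≤ ∑ j ∈ range (p + 1), n ^ p * 2 ^ p := by
        refine sum_le_sum fun j hj => ?_
        have hj : j ≤ p := by simpa [Nat.lt_succ_iff] using hj
        exact Nat.mul_le_mul ((Nat.choose_le_pow n j).trans (Nat.pow_le_pow_right hn hj))
          (Nat.pow_le_pow_right (by norm_num) hj)
    _ = (p + 1) * (2 ^ p * n ^ p) := by simp; ring
    _ ≤ 2 ^ p * (2 ^ p * n ^ p) := Nat.mul_le_mul_right _ (Nat.lt_two_pow_self)
    _ = 4 ^ p * n ^ p := by
        rw [← mul_assoc, ← mul_pow]; norm_num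

theorem sum_range_getD {α : Type*} (L : List α) (d : α) (f : α → ℕ) :
    ∑ i ∈ range L.length, f (L.getD i d) = (L.map f).sum := by
  induction L with
  | nil => simp
  | cons a l ih =>
    rw [List.length_cons, sum_range_succ']
    simp only [List.getD_cons_succ, List.getD_cons_zero, ih, List.map_cons, List.sum_cons, add_comm]

/-! ### A small pool of rows -/

/-- `a x + b` modulo `Q`, computed by repeated addition.  The value is only meaningful if
`a, b < Q`. -/
def hashVal (Q a b : ℕ) : ℕ → ℕ
  | 0 => b
  | x + 1 => if Q ≤ hashVal Q a b x + a then hashVal Q a b x + a - Q else hashVal Q a b x + a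

/-- The row with entry `1` in the columns `x` with `(a x + b) mod Q < B`. -/
def poolRow (Q B a b x : ℕ) : ℕ := if hashVal Q a b x < B then 1 else 0

theorem poolRow_le_one (Q B a b x : ℕ) : poolRow Q B a b x ≤ 1 := by
  unfold poolRow; split_ifs <;> omega

theorem hashVal_eq {Q a b : ℕ} (ha : a < Q) (hb : b < Q) (x : ℕ) :
    hashVal Q a b x = (a * x + b) % Q := by
  induction x with
  | zero => simp [hashVal, Nat.mod_eq_of_lt hb]
  | succ x ih =>
    have h1 : (a * (x + 1) + b) % Q = ((a * x + b) % Q + a) % Q := by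
      rw [Nat.mod_add_mod]; congr 1; ring
    have h2 := Nat.mod_lt (a * x + b) (Nat.zero_lt_of_lt ha)
    rw [hashVal, ih, h1]
    generalize (a * x + b) % Q = y at h2
    split_ifs with h
    · rw [Nat.mod_eq_sub_mod h, Nat.mod_eq_of_lt (by omega)]
    · rw [Nat.mod_eq_of_lt (by omega)]

/-- The hash function is uniform: at least `Q * B` of the `Q ^ 2` pairs `(a, b)` select `s`. -/
theorem card_select_ge {Q B : ℕ} (hB : B ≤ Q) (s : ℕ) :
    Q * B ≤ #{c ∈ range Q ×ˢ range Q | (c.1 * s + c.2) % Q < B} := by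
  rcases Nat.eq_zero_or_pos Q with rfl | hQ
  · simp
  have key : ∀ a c, c < Q → (a * s + (c + (Q - a * s % Q)) % Q) % Q = c := by
    intro a c hc
    have hlt := Nat.mod_lt (a * s) hQ
    rw [Nat.add_mod_mod, ← Nat.mod_add_mod,
      show a * s % Q + (c + (Q - a * s % Q)) = c + Q by omega, Nat.add_mod_right,
      Nat.mod_eq_of_lt hc]
  calc Q * B = #(range Q ×ˢ range B) := by simp
    _ ≤ _ := by
      refine card_le_card_of_injOn (fun c => (c.1, (c.2 + (Q - c.1 * s % Q)) % Q)) ?_ ?_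
      · rintro ⟨a, c⟩ h
        simp only [coe_product, coe_range, Set.mem_prod, Set.mem_Iio] at h
        simp only [coe_filter, mem_product, mem_range, Set.mem_ofPred_eq]
        refine ⟨⟨h.1, Nat.mod_lt _ hQ⟩, ?_⟩
        rw [key a c (by omega)]; exact h.2
      · rintro ⟨a, c⟩ h ⟨a', c'⟩ h' heq
        simp only [coe_product, coe_range, Set.mem_prod, Set.mem_Iio] at h h'
        simp only [Prod.mk.injEq] at heq ⊢
        obtain ⟨rfl, h2⟩ := heq
        refine ⟨rfl, ?_⟩
        rw [← key a c (by omega), ← key a c' (by omega), h2]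

/-- The hash function is pairwise independent: at most `B ^ 2` of the pairs `(a, b)` select both
`s` and `t`. -/
theorem card_select_both_le {Q B s t : ℕ} (hQ : Q.Prime) (hs : s < Q) (ht : t < Q) (hst : s ≠ t) :
    #{c ∈ range Q ×ˢ range Q | (c.1 * s + c.2) % Q < B ∧ (c.1 * t + c.2) % Q < B} ≤ B * B := by
  have : Fact Q.Prime := ⟨hQ⟩
  calc _ ≤ #(range B ×ˢ range B) := by
        refine card_le_card_of_injOn (fun c => ((c.1 * s + c.2) % Q, (c.1 * t + c.2) % Q)) ?_ ?_
        · rintro ⟨a, c⟩ h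
          simp only [coe_filter, mem_product, mem_range, Set.mem_ofPred_eq] at h
          simpa using h.2
        · rintro ⟨a, b⟩ h ⟨a', b'⟩ h' heq
          simp only [coe_filter, mem_product, mem_range, Set.mem_ofPred_eq] at h h'
          simp only [Prod.mk.injEq] at heq ⊢
          have e1 : ((a * s + b : ℕ) : ZMod Q) = (a' * s + b' : ℕ) :=
            (ZMod.natCast_eq_natCast_iff _ _ _).2 heq.1
          have e2 : ((a * t + b : ℕ) : ZMod Q) = (a' * t + b' : ℕ) :=
            (ZMod.natCast_eq_natCast_iff _ _ _).2 heq.2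
          push_cast at e1 e2
          have hne : (s : ZMod Q) - t ≠ 0 := by
            intro h0
            have := (ZMod.natCast_eq_natCast_iff s t Q).1 (sub_eq_zero.1 h0)
            rw [Nat.ModEq, Nat.mod_eq_of_lt hs, Nat.mod_eq_of_lt ht] at this
            exact hst this
          have e3 : ((a : ZMod Q) - a') * (s - t) = 0 := by linear_combination e1 - e2
          have ha : (a : ZMod Q) = a' := by
            rcases mul_eq_zero.1 e3 with h0 | h0
            · exact sub_eq_zero.1 h0
            · exact absurd h0 hne
          have hb : (b : ZMod Q) = b' := by rw [ha] at e1; exact add_left_cancel e1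
          rw [ZMod.natCast_eq_natCast_iff, Nat.ModEq] at ha hb
          rw [Nat.mod_eq_of_lt h.1.1, Nat.mod_eq_of_lt h'.1.1] at ha
          rw [Nat.mod_eq_of_lt h.1.2, Nat.mod_eq_of_lt h'.1.2] at hb
          exact ⟨ha, hb⟩
    _ = B * B := by simp

/-- The rows of the pool hit an event `(S, T)` with `|S| ≤ d` with frequency at least
`|T| / (8 d)`. -/
theorem card_hit_ge {n d Q : ℕ} (hQ : Q.Prime) (hn : n ≤ Q) (hd : 1 ≤ d) (hdQ : 2 * d ≤ Q)
    {e : Event} (hT : e.2 ⊆ e.1) (hS : e.1 ⊆ range n) (hc : e.1.card ≤ d) :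
    e.2.card * (Q * Q) ≤
      8 * d * #{c ∈ range Q ×ˢ range Q | Hit (poolRow Q (Q / (2 * d)) c.1 c.2) e} := by
  obtain ⟨S, T⟩ := e
  dsimp only at hT hS hc ⊢
  set B := Q / (2 * d) with hB
  have hB1 : 1 ≤ B := (Nat.one_le_div_iff (by omega)).2 hdQ
  have hBQ : 2 * d * B ≤ Q := Nat.mul_div_le Q (2 * d)
  have hQB : Q < 2 * d * (B + 1) := Nat.lt_mul_div_succ Q (by omega)
  have hBle : B ≤ Q := Nat.div_le_self _ _
  let sel : ℕ → ℕ × ℕ → Prop := fun s c => (c.1 * s + c.2) % Q < B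
  let G : ℕ → Finset (ℕ × ℕ) := fun s =>
    {c ∈ range Q ×ˢ range Q | sel s c ∧ ∀ t ∈ S.erase s, ¬ sel t c}
  have hrow : ∀ c ∈ range Q ×ˢ range Q, ∀ x, poolRow Q B c.1 c.2 x = if sel x c then 1 else 0 := by
    intro c hc x
    rw [mem_product, mem_range, mem_range] at hc
    rw [poolRow, hashVal_eq hc.1 hc.2]
  have hG : ∀ s ∈ S, Q * B ≤ 2 * #(G s) := by
    intro s hs
    have h1 : #{c ∈ range Q ×ˢ range Q | sel s c} ≤
        #(G s ∪ (S.erase s).biUnion fun t => {c ∈ range Q ×ˢ range Q | sel s c ∧ sel t c}) := by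
      refine card_le_card fun c hc => ?_
      rw [mem_filter] at hc
      rw [mem_union, mem_biUnion, mem_filter]
      by_cases h : ∃ t ∈ S.erase s, sel t c
      · obtain ⟨t, ht, h⟩ := h
        exact .inr ⟨t, ht, mem_filter.2 ⟨hc.1, hc.2, h⟩⟩
      · push Not at h
        exact .inl ⟨hc.1, hc.2, h⟩
    have h2 : #((S.erase s).biUnion fun t => {c ∈ range Q ×ˢ range Q | sel s c ∧ sel t c}) ≤
        (S.erase s).card * (B * B) := by
      refine card_biUnion_le_card_mul _ _ _ fun t ht => ?_
      rw [mem_erase] at ht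
      exact card_select_both_le hQ ((mem_range.1 (hS hs)).trans_le hn)
        ((mem_range.1 (hS ht.2)).trans_le hn) ht.1.symm
    have h3 : Q * B ≤ #{c ∈ range Q ×ˢ range Q | sel s c} := card_select_ge hBle s
    have h4 := card_union_le (G s)
      ((S.erase s).biUnion fun t => {c ∈ range Q ×ˢ range Q | sel s c ∧ sel t c})
    have h5 : (S.erase s).card * (B * B) ≤ d * (B * B) :=
      Nat.mul_le_mul_right _ ((card_erase_le).trans hc)
    have h6 : 2 * (d * (B * B)) ≤ Q * B := by
      calc 2 * (d * (B * B)) = 2 * d * B * B := by ring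
        _ ≤ Q * B := Nat.mul_le_mul_right _ hBQ
    omega
  have hdisj : (T : Set ℕ).PairwiseDisjoint G := by
    intro s hs t ht hst
    refine disjoint_left.2 fun c h1 h2 => ?_
    rw [mem_filter] at h1 h2
    exact h2.2.2 s (mem_erase.2 ⟨hst, hT hs⟩) h1.2.1
  have hsub : T.biUnion G ⊆ {c ∈ range Q ×ˢ range Q | Hit (poolRow Q B c.1 c.2) (S, T)} := by
    intro c hc
    rw [mem_biUnion] at hc
    obtain ⟨s, hs, hc⟩ := hc
    rw [mem_filter] at hc
    rw [mem_filter]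
    have h0 : ∀ t ∈ S, t ≠ s → poolRow Q B c.1 c.2 t = 0 := by
      intro t ht hts
      rw [hrow c hc.1, if_neg (hc.2.2 t (mem_erase.2 ⟨hts, ht⟩))]
    have h1 : poolRow Q B c.1 c.2 s = 1 := by rw [hrow c hc.1, if_pos hc.2.1]
    refine ⟨hc.1, ?_, ?_⟩
    · rw [sum_eq_single_of_mem s (hT hs) h0, h1]
    · rw [sum_eq_single_of_mem s hs fun t ht => h0 t (hT ht), h1]
  have hcard := card_le_card hsub
  rw [card_biUnion hdisj] at hcard
  have hsum : T.card * (Q * B) ≤ 2 * ∑ s ∈ T, #(G s) := by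
    rw [mul_sum, ← smul_eq_mul, ← sum_const]
    exact sum_le_sum fun s hs => hG s (hT hs)
  have hfin : Q ≤ 4 * d * B := by nlinarith
  calc T.card * (Q * Q) ≤ T.card * (Q * (4 * d * B)) := by gcongr
    _ = 4 * d * (T.card * (Q * B)) := by ring
    _ ≤ 4 * d * (2 * ∑ s ∈ T, #(G s)) := by gcongr
    _ = 8 * d * ∑ s ∈ T, #(G s) := by ring
    _ ≤ _ := by gcongr

/-- One step of the derandomization. Among the rows of the pool with density about `1 / (2 p)` and
those with density about `1 / (2 g)` there is one for which the total weight of the surviving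
events drops as much as it does on average. -/
theorem exists_good_row {n p g E : ℕ} (hg : 1 ≤ g) (hgp : g ≤ p) (hpn : 2 * p ≤ n)
    (τ X : ℕ → ℕ)
    (hX : ∀ j, X j = 16 * (p * g) - τ j * if j ≤ g then p else g)
    (ev : ℕ → Event) (hev : ∀ i < E, (ev i).2 ⊆ (ev i).1 ∧ (ev i).1 ⊆ range n ∧ (ev i).1.card ≤ p)
    (A : ℕ → ℕ) (hA : ∀ i < E, A i ≠ 0 → (ev i).2.card = τ (ev i).1.card) (r : ℕ) :
    ∃ Q < 2 * n + 1, ∃ B < 2 * n + 1, ∃ a < 2 * n + 1, ∃ b < 2 * n + 1,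
      16 * (p * g) * ∑ i ∈ range E,
          (if A i ≠ 0 ∧ ¬ Hit (poolRow Q B a b) (ev i) then X (ev i).1.card ^ r else 0) ≤
        ∑ i ∈ range E, if A i ≠ 0 then X (ev i).1.card ^ (r + 1) else 0 := by
  obtain ⟨Q, hQ, hnQ, hQn⟩ := Nat.exists_prime_lt_and_le_two_mul n (by omega)
  set Φ := ∑ i ∈ range E, if A i ≠ 0 then X (ev i).1.card ^ (r + 1) else 0 with hΦ
  let F : ℕ → ℕ × ℕ → ℕ := fun B c => ∑ i ∈ range E,
    if A i ≠ 0 ∧ ¬ Hit (poolRow Q B c.1 c.2) (ev i) then X (ev i).1.card ^ r else 0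
  let P := range Q ×ˢ range Q
  suffices h : ∃ d, 1 ≤ d ∧ ∃ c ∈ P, 16 * (p * g) * F (Q / (2 * d)) c ≤ Φ by
    obtain ⟨d, hd, c, hc, h⟩ := h
    rw [mem_product, mem_range, mem_range] at hc
    have := Nat.div_le_self Q (2 * d)
    exact ⟨Q, by omega, Q / (2 * d), by omega, c.1, by omega, c.2, by omega, h⟩
  by_contra! hcon
  have hF : ∀ B, ∑ c ∈ P, F B c = ∑ i ∈ range E, if A i ≠ 0 then
      X (ev i).1.card ^ r * #{c ∈ P | ¬ Hit (poolRow Q B c.1 c.2) (ev i)} else 0 := by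
    intro B
    rw [sum_comm]
    refine sum_congr rfl fun i _ => ?_
    by_cases h : A i = 0
    · simp [h]
    · simp only [ne_eq, h, not_false_eq_true, true_and, if_true]
      rw [← sum_filter, sum_const, smul_eq_mul, mul_comm]
  have hlow : ∀ d, 1 ≤ d → Q * Q * Φ < 16 * (p * g) * ∑ c ∈ P, F (Q / (2 * d)) c := by
    intro d hd
    have : ∑ c ∈ P, Φ < ∑ c ∈ P, 16 * (p * g) * F (Q / (2 * d)) c :=
      sum_lt_sum_of_nonempty ⟨(0, 0), by simp [P, hQ.pos]⟩ fun c hc => hcon d hd c hc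
    rwa [sum_const, smul_eq_mul, ← mul_sum, card_product, card_range] at this
  have hup : 16 * (p * g) * (∑ c ∈ P, F (Q / (2 * p)) c + ∑ c ∈ P, F (Q / (2 * g)) c) ≤
      2 * (Q * Q) * Φ := by
    rw [hF, hF, ← sum_add_distrib, mul_sum, hΦ, mul_sum]
    refine sum_le_sum fun i hi => ?_
    rw [mem_range] at hi
    by_cases h : A i = 0
    · simp [h]
    simp only [ne_eq, h, not_false_eq_true, if_true]
    obtain ⟨h1, h2, h3⟩ := hev i hi
    have hp8 := card_hit_ge hQ hnQ.le (hg.trans hgp) (by omega) h1 h2 h3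
    have cp := card_filter_add_card_filter_not (s := P)
      (fun c => Hit (poolRow Q (Q / (2 * p)) c.1 c.2) (ev i))
    have cg := card_filter_add_card_filter_not (s := P)
      (fun c => Hit (poolRow Q (Q / (2 * g)) c.1 c.2) (ev i))
    have hPc : #P = Q * Q := by simp [P]
    rw [hPc] at cp cg
    have hXi := hX (ev i).1.card
    rw [← hA i hi h] at hXi
    set up := #{c ∈ P | ¬ Hit (poolRow Q (Q / (2 * p)) c.1 c.2) (ev i)}
    set ug := #{c ∈ P | ¬ Hit (poolRow Q (Q / (2 * g)) c.1 c.2) (ev i)}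
    set xp := #{c ∈ P | Hit (poolRow Q (Q / (2 * p)) c.1 c.2) (ev i)}
    set xg := #{c ∈ P | Hit (poolRow Q (Q / (2 * g)) c.1 c.2) (ev i)}
    have hmain : 16 * (p * g) * (up + ug) ≤ 2 * (Q * Q) * X (ev i).1.card := by
      rw [hXi, Nat.mul_sub]
      refine Nat.le_sub_of_add_le ?_
      have hsum : 2 * (Q * Q) = up + ug + (xp + xg) := by omega
      have hrate : 2 * (Q * Q) * ((ev i).2.card * if (ev i).1.card ≤ g then p else g) ≤
          16 * (p * g) * (xp + xg) := by
        split_ifs with hj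
        · have hg8 := card_hit_ge hQ hnQ.le hg (by omega) h1 h2 hj
          calc 2 * (Q * Q) * ((ev i).2.card * p) = 2 * p * ((ev i).2.card * (Q * Q)) := by ring
            _ ≤ 2 * p * (8 * g * xg) := Nat.mul_le_mul_left _ hg8
            _ = 16 * (p * g) * xg := by ring
            _ ≤ _ := Nat.mul_le_mul_left _ (Nat.le_add_left _ _)
        · calc 2 * (Q * Q) * ((ev i).2.card * g) = 2 * g * ((ev i).2.card * (Q * Q)) := by ring
            _ ≤ 2 * g * (8 * p * xp) := Nat.mul_le_mul_left _ hp8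
            _ = 16 * (p * g) * xp := by ring
            _ ≤ _ := Nat.mul_le_mul_left _ (Nat.le_add_right _ _)
      have : 2 * (Q * Q) * (16 * (p * g)) =
          16 * (p * g) * (up + ug) + 16 * (p * g) * (xp + xg) := by
        rw [hsum]; ring
      omega
    calc 16 * (p * g) * (X (ev i).1.card ^ r * up + X (ev i).1.card ^ r * ug)
        = X (ev i).1.card ^ r * (16 * (p * g) * (up + ug)) := by ring
      _ ≤ X (ev i).1.card ^ r * (2 * (Q * Q) * X (ev i).1.card) := Nat.mul_le_mul_left _ hmain
      _ = _ := by ring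
  have l1 := hlow p (hg.trans hgp)
  have l2 := hlow g hg
  rw [mul_add] at hup
  have : 2 * (Q * Q) * Φ = Q * Q * Φ + Q * Q * Φ := by ring
  omega

/-! ### Reduction to hitting events, and the number of rows -/

/-- `j - v_j + 1`: a matrix is a `(j, v_j, n)`-selector if some row hits `(S, T)`, whenever
`|S| = j`, `T ⊆ S` and `|T| = threshold v j`.  The value at `j = 0` is chosen such that no event
with `S = ∅` counts. -/
def threshold (v : ℕ → ℕ) (j : ℕ) : ℕ := if j = 0 then 1 else j + 1 - v j

theorem isSuperselector_of_hit {m n p : ℕ} {v : ℕ → ℕ} (R : ℕ → ℕ → ℕ)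
    (h1 : ∀ i < m, ∀ x < n, R i x ≤ 1)
    (h : ∀ S T : Finset ℕ, T ⊆ S → S ⊆ range n → S.card ≤ p → T.card = threshold v S.card →
      ∃ i < m, Hit (R i) (S, T)) :
    IsSuperselector p v (fun (r : Fin m) (c : Fin n) => decide (R r c = 1)) := by
  classical
  intro i hi hip S hS
  by_contra! hlt
  set F := S.filter fun s => ∃ r : Fin m, ∀ t ∈ S, decide (R r t = 1) = decide (t = s) with hF
  have hlt' : F.card < v i := by
    refine lt_of_le_of_lt (le_of_eq ?_) hlt
    congr
  have hFS : F ⊆ S := filter_subset _ _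
  have hcard : threshold v i ≤ (S \ F).card := by
    have h1 := card_sdiff_add_card_eq_card hFS
    rw [threshold, if_neg (by omega)]
    omega
  obtain ⟨T, hTsub, hTcard⟩ := exists_subset_card_eq hcard
  have hTS : T ⊆ S := hTsub.trans sdiff_subset
  obtain ⟨r, hr, hsumS, hsumT⟩ := h (S.map Fin.valEmbedding) (T.map Fin.valEmbedding)
    (map_subset_map.2 hTS)
    (by
      intro x hx
      obtain ⟨y, -, rfl⟩ := mem_map.1 hx
      exact mem_range.2 y.2)
    (by rw [card_map]; omega) (by rw [card_map, card_map, hTcard, hS])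
  simp only [sum_map, Fin.valEmbedding_apply] at hsumS hsumT
  obtain ⟨s, hsT, hs0⟩ : ∃ s ∈ T, R r s ≠ 0 := by
    by_contra! hall
    rw [sum_eq_zero hall] at hsumT
    omega
  have hs1 : R r s = 1 := by have := h1 r hr s s.2; omega
  have hsS := hTS hsT
  rw [← add_sum_erase S _ hsS, hs1] at hsumS
  have hzero : ∑ x ∈ S.erase s, R r x = 0 := by omega
  rw [sum_eq_zero_iff] at hzero
  have hmem : s ∈ F := by
    rw [hF, mem_filter]
    refine ⟨hsS, ⟨r, hr⟩, fun t ht => ?_⟩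
    by_cases hts : t = s
    · simp [hts, hs1]
    · simp [hts, hzero t (mem_erase.2 ⟨hts, ht⟩)]
  exact (mem_sdiff.1 (hTsub hsT)).2 hmem

/-- The identity matrix is a superselector. -/
theorem isSuperselector_identity {n p : ℕ} {v : ℕ → ℕ} (hv : ∀ i, 1 ≤ i → i ≤ p → v i ≤ i) :
    IsSuperselector p v (fun r c : Fin n => decide (r = c)) := by
  intro i hi hip S hS
  refine (hv i hi hip).trans (hS.symm.le.trans (card_le_card fun s hs => ?_))
  simp only [mem_filter]
  exact ⟨hs, s, fun t _ => by simp [eq_comm]⟩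

section Size

variable {n p : ℕ} {v : ℕ → ℕ}

theorem threshold_pos (hv : ∀ i, 1 ≤ i → i ≤ p → v i ≤ i) {j : ℕ} (hj : j ≤ p) :
    1 ≤ threshold v j := by
  unfold threshold
  split_ifs with h
  · exact le_rfl
  · have := hv j (by omega) hj; omega

theorem threshold_le (v : ℕ → ℕ) (j : ℕ) : threshold v j ≤ j + 1 := by
  unfold threshold; split_ifs <;> omega

theorem superK_eq (hv : ∀ i, 1 ≤ i → i ≤ p → v i ≤ i) {j : ℕ} (h1 : 1 ≤ j) (hj : j ≤ p) :
    superK p v j = min (3 * Real.exp 1 * (p * j / threshold v j))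
      (Real.exp 1 * Real.log 2 * (j : ℝ) ^ 2) := by
  have := hv j h1 hj
  rw [superK, threshold, if_neg (by omega), Nat.cast_sub (by omega)]
  congr 1
  · push_cast
    rw [show (j : ℝ) + 1 - v j = j - v j + 1 by ring]
    ring
  · rw [Real.logb, Real.log_exp]
    field_simp

theorem one_le_exp_mul_log_two : 1 ≤ Real.exp 1 * Real.log 2 := by
  have h1 := Real.exp_one_gt_d9
  have h2 := Real.log_two_gt_d9
  nlinarith

theorem half_le_log_div {n j : ℕ} (hj : 1 ≤ j) (hjn : 2 * j ≤ n) :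
    1 / 2 ≤ Real.log ((n : ℝ) / j) := by
  have h2 := Real.log_two_gt_d9
  have hj' : (0 : ℝ) < j := by exact_mod_cast hj
  have : (2 : ℝ) ≤ n / j := by
    rw [le_div_iff₀ hj']; exact_mod_cast hjn
  have := Real.log_le_log (by norm_num) this
  linarith

theorem le_superBound (hp : 1 ≤ p) {j : ℕ} (h1 : 1 ≤ j) (hj : j ≤ p) :
    superK p v j * Real.log ((n : ℝ) / j) ≤ superBound n p v hp :=
  le_sup' (fun j : ℕ => superK p v j * Real.log ((n : ℝ) / (j : ℝ))) (mem_Icc.2 ⟨h1, hj⟩)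

theorem superBound_le (hp : 1 ≤ p) (hpn : p ≤ n) (hv : ∀ i, 1 ≤ i → i ≤ p → v i ≤ i) :
    superBound n p v hp ≤ 3 * (n : ℝ) ^ 3 := by
  refine sup'_le _ _ fun j hj => ?_
  rw [mem_Icc] at hj
  rw [superK_eq hv hj.1 hj.2]
  have hjn : (j : ℝ) ≤ n := by exact_mod_cast hj.2.trans hpn
  have h1j : (1 : ℝ) ≤ j := by exact_mod_cast hj.1
  have hn0 : (0 : ℝ) ≤ n := by positivity
  have hlog : Real.log ((n : ℝ) / j) ≤ n := by
    have h1 : (n : ℝ) / j ≤ n := div_le_self hn0 h1j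
    have h2 := Real.log_le_sub_one_of_pos (show (0 : ℝ) < n / j by
      apply div_pos <;> linarith)
    linarith
  have hlog0 : 0 ≤ Real.log ((n : ℝ) / j) := Real.log_nonneg (by rwa [one_le_div (by linarith)])
  have he := Real.exp_one_lt_d9
  have hl2 := Real.log_two_lt_d9
  have hk : min (3 * Real.exp 1 * (p * j / threshold v j))
      (Real.exp 1 * Real.log 2 * (j : ℝ) ^ 2) ≤ 3 * (n : ℝ) ^ 2 := by
    refine (min_le_right _ _).trans ?_
    have hl0 := Real.log_two_gt_d9
    have hc : Real.exp 1 * Real.log 2 ≤ 3 := by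
      have := Real.exp_pos 1
      nlinarith
    gcongr
  calc _ ≤ 3 * (n : ℝ) ^ 2 * n := mul_le_mul hk hlog hlog0 (by positivity)
    _ = _ := by ring

theorem card_le_superBound (hn : 2 ≤ n) (hp : 1 ≤ p) (hnp : n < 2 * p)
    (hv : ∀ i, 1 ≤ i → i ≤ p → v i ≤ i) : (n : ℝ) ≤ 6 * superBound n p v hp := by
  have hj1 : 1 ≤ n / 2 := by omega
  have hjp : n / 2 ≤ p := by omega
  have hk := le_superBound (n := n) (v := v) hp hj1 hjp
  rw [superK_eq hv hj1 hjp] at hk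
  have hlog := half_le_log_div hj1 (show 2 * (n / 2) ≤ n by omega)
  have hT1 := threshold_pos hv hjp
  have hT2 := threshold_le v (n / 2)
  have hn3 : n ≤ 3 * (n / 2) := by omega
  set j := n / 2
  set T := threshold v j
  have hT1' : (1 : ℝ) ≤ T := by exact_mod_cast hT1
  have hT2' : (T : ℝ) ≤ j + 1 := by exact_mod_cast hT2
  have hj1' : (1 : ℝ) ≤ j := by exact_mod_cast hj1
  have hn3' : (n : ℝ) ≤ 3 * j := by exact_mod_cast hn3
  have hjp' : (j : ℝ) ≤ p := by exact_mod_cast hjp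
  have he := Real.exp_one_gt_d9
  have hmin : (n : ℝ) / 3 ≤ min (3 * Real.exp 1 * (p * j / T))
      (Real.exp 1 * Real.log 2 * (j : ℝ) ^ 2) := by
    refine le_min ?_ ?_
    · have h1 : (p : ℝ) / 2 ≤ p * j / T := by
        rw [div_le_div_iff₀ (by norm_num) (by linarith)]
        nlinarith
      nlinarith
    · have := one_le_exp_mul_log_two
      nlinarith
  have : (n : ℝ) / 3 * (1 / 2) ≤ superBound n p v hp :=
    (mul_le_mul hmin hlog (by norm_num) (le_trans (by positivity) hmin)).trans hk
  linarith

theorem choose_le_exp {n j : ℕ} (hj : 1 ≤ j) :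
    (n.choose j : ℝ) ≤ (Real.exp 1 * n / j) ^ j := by
  have hj0 : (0 : ℝ) < j := by exact_mod_cast hj
  have h1 : (n.choose j : ℝ) ≤ (n : ℝ) ^ j / j.factorial := Nat.choose_le_pow_div j n
  have h2 : (j : ℝ) ^ j / j.factorial ≤ Real.exp j := Real.pow_div_factorial_le_exp _ hj0.le j
  have h3 : Real.exp (j : ℝ) = Real.exp 1 ^ j := by rw [← Real.exp_nat_mul, mul_one]
  rw [h3] at h2
  have hf : (0 : ℝ) < j.factorial := by exact_mod_cast j.factorial_pos
  refine h1.trans ?_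
  rw [div_pow, mul_pow, div_le_div_iff₀ hf (by positivity)]
  rw [div_le_iff₀ hf] at h2
  calc (n : ℝ) ^ j * j ^ j ≤ n ^ j * (Real.exp 1 ^ j * j.factorial) := by gcongr
    _ = _ := by ring

/-- With `m` rows, the events with `|S| = j` have total weight at most `2 ^ (-j)`, if `m` is large
compared with `j log (n / j)` divided by the frequency with which the events are hit. -/
theorem weight_le {n j T D m : ℕ} (hj : 1 ≤ j) (hjn : 2 * j ≤ n) (hD : 1 ≤ D) (hT : T ≤ 16 * D)
    (hm : 80 * ((D : ℝ) * j) * Real.log (n / j) ≤ m * T) :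
    (n.choose j : ℝ) * 2 ^ j * (1 - T / (16 * D)) ^ m ≤ (1 / 2) ^ j := by
  have hj0 : (0 : ℝ) < j := by exact_mod_cast hj
  have hD0 : (0 : ℝ) < D := by exact_mod_cast hD
  have hn0 : (0 : ℝ) < n := by exact_mod_cast (show 0 < n by omega)
  have hbase : 0 ≤ 1 - (T : ℝ) / (16 * D) := by
    have : (T : ℝ) ≤ 16 * D := by exact_mod_cast hT
    rw [sub_nonneg, div_le_one (by positivity)]; exact this
  have h1 : (1 - (T : ℝ) / (16 * D)) ^ m ≤ Real.exp (-(m * T / (16 * D))) := by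
    calc (1 - (T : ℝ) / (16 * D)) ^ m ≤ Real.exp (-(T / (16 * D))) ^ m := by
          gcongr; exact Real.one_sub_le_exp_neg _
      _ = _ := by rw [← Real.exp_nat_mul]; congr 1; ring
  have h2 : 5 * (j * Real.log (n / j)) ≤ m * T / (16 * D) := by
    rw [le_div_iff₀ (by positivity)]
    calc _ = 80 * ((D : ℝ) * j) * Real.log (n / j) := by ring
      _ ≤ _ := hm
  have h3 : Real.exp (5 * (j * Real.log (n / j))) = (((n : ℝ) / j) ^ 5) ^ j := by
    rw [← Real.exp_log (show (0 : ℝ) < ((n : ℝ) / j) ^ 5 by positivity), ← Real.exp_nat_mul,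
      Real.log_pow]
    congr 1; push_cast; ring
  have hq : (2 : ℝ) ≤ n / j := by
    rw [le_div_iff₀ hj0]; exact_mod_cast hjn
  have h4 : Real.exp 1 * n / j * 2 * 2 ≤ ((n : ℝ) / j) ^ 5 := by
    have he := Real.exp_one_lt_d9
    have h16 : (2 : ℝ) ^ 4 ≤ ((n : ℝ) / j) ^ 4 := by gcongr
    calc Real.exp 1 * n / j * 2 * 2 = Real.exp 1 * 4 * (n / j) := by ring
      _ ≤ 2 ^ 4 * (n / j) := by gcongr; linarith
      _ ≤ (n / j) ^ 4 * (n / j) := by gcongr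
      _ = _ := by ring
  have h5 : (n.choose j : ℝ) * 2 ^ j * 2 ^ j ≤ Real.exp (m * T / (16 * D)) := by
    calc (n.choose j : ℝ) * 2 ^ j * 2 ^ j ≤ (Real.exp 1 * n / j) ^ j * 2 ^ j * 2 ^ j := by
          gcongr; exact choose_le_exp hj
      _ = (Real.exp 1 * n / j * 2 * 2) ^ j := by rw [mul_pow, mul_pow]
      _ ≤ (((n : ℝ) / j) ^ 5) ^ j := by gcongr
      _ ≤ _ := by rw [← h3]; exact Real.exp_le_exp.2 h2
  have h6 : (0 : ℝ) < 2 ^ j := by positivity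
  rw [Real.exp_neg] at h1
  have hE := Real.exp_pos ((m : ℝ) * T / (16 * D))
  calc _ ≤ (n.choose j : ℝ) * 2 ^ j * (Real.exp (m * T / (16 * D)))⁻¹ := by gcongr
    _ ≤ (1 / 2) ^ j := by
      rw [← div_eq_mul_inv, div_le_iff₀ hE, one_div, inv_pow, ← div_eq_inv_mul, le_div_iff₀ h6]
      exact h5

/-- There is a number `m` of rows for which the greedy choice succeeds, within the bound. -/
theorem exists_size (hp : 1 ≤ p) (hpn : 2 * p ≤ n)
    (hv : ∀ i, 1 ≤ i → i ≤ p → v i ≤ i) {g : ℕ} (hg : 1 ≤ g) (hgp : g ≤ p)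
    (hgT : g * threshold v g ≤ 2 * p) (hgj : ∀ j ≤ p, g < j → 2 * p < j * threshold v j) :
    ∃ m : ℕ, (∑ j ∈ range (p + 1), n.choose j * 2 ^ j *
        (if j = 0 then 0 else (16 * (p * g) - threshold v j * if j ≤ g then p else g) ^ m)) <
          (16 * (p * g)) ^ m ∧
      (m : ℝ) ≤ 242 * superBound n p v hp := by
  set β := superBound n p v hp with hβ
  have hgR : (1 : ℝ) ≤ g := by exact_mod_cast hg
  have hpR : (1 : ℝ) ≤ p := by exact_mod_cast hp
  have he := Real.exp_one_gt_d9
  have hel := one_le_exp_mul_log_two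
  have hlg := half_le_log_div hg (show 2 * g ≤ n by omega)
  have hβg : (g : ℝ) ^ 2 * Real.log (n / g) ≤ β := by
    refine le_trans ?_ (le_superBound hp hg hgp)
    rw [superK_eq hv hg hgp]
    refine mul_le_mul_of_nonneg_right (le_min ?_ ?_) (by linarith)
    · have hT : (0 : ℝ) < threshold v g := by exact_mod_cast threshold_pos hv hgp
      have hgT' : (g : ℝ) * threshold v g ≤ 2 * p := by exact_mod_cast hgT
      have h1 : (g : ℝ) ^ 2 / 2 ≤ p * g / threshold v g := by
        rw [div_le_div_iff₀ (by norm_num) hT]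
        nlinarith
      nlinarith
    · nlinarith [sq_nonneg (g : ℝ)]
  have hβ1 : 1 ≤ 2 * β := by nlinarith
  refine ⟨⌈240 * β⌉₊, ?_, ?_⟩
  swap
  · have := Nat.ceil_lt_add_one (show 0 ≤ 240 * β by linarith)
    linarith
  set m := ⌈240 * β⌉₊
  have hm : 240 * β ≤ m := Nat.le_ceil _
  have key : ∀ j, 1 ≤ j → j ≤ p → (n.choose j : ℝ) * 2 ^ j *
      ((16 * (p * g) - threshold v j * if j ≤ g then p else g : ℕ) : ℝ) ^ m ≤
        (1 / 2) ^ j * ((16 * (p * g) : ℕ) : ℝ) ^ m := by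
    intro j hj hjp
    have hT := threshold_pos hv hjp
    have hT2 := threshold_le v j
    have hj1 : (1 : ℝ) ≤ j := by exact_mod_cast hj
    have hlj := half_le_log_div hj (show 2 * j ≤ n by omega)
    have hT0 : (0 : ℝ) < threshold v j := by exact_mod_cast hT
    have hT1 : (1 : ℝ) ≤ threshold v j := by exact_mod_cast hT
    obtain ⟨D, hD1, hTD, hDD, hmD⟩ : ∃ D : ℕ, 1 ≤ D ∧ threshold v j ≤ 16 * D ∧
        (D * if j ≤ g then p else g) = p * g ∧
        80 * ((D : ℝ) * j) * Real.log (n / j) ≤ m * threshold v j := by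
      by_cases hjg : j ≤ g
      · refine ⟨g, hg, by omega, by simp [hjg, mul_comm], ?_⟩
        have hjg' : (j : ℝ) ≤ g := by exact_mod_cast hjg
        -- the function `x ↦ x log (n / x)` is almost increasing in the range `x ≤ n / 2`
        have hmono : j * Real.log (n / j) ≤ 3 * (g * Real.log (n / g)) := by
          have hn0 : (0 : ℝ) < n := by exact_mod_cast (show 0 < n by omega)
          have e1 : Real.log (n / j) = Real.log (n / g) + Real.log (g / j) := by
            rw [← Real.log_mul (by positivity) (by positivity)]
            congr 1; field_simp
          have e2 := Real.log_le_sub_one_of_pos (show (0 : ℝ) < g / j by positivity)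
          have e3 : j * Real.log (g / j) ≤ g - j := by
            calc j * Real.log (g / j) ≤ j * ((g : ℝ) / j - 1) := by gcongr
              _ = g - j := by field_simp
          rw [e1, mul_add]
          nlinarith
        calc 80 * ((g : ℝ) * j) * Real.log (n / j) = 80 * g * (j * Real.log (n / j)) := by ring
          _ ≤ 80 * g * (3 * (g * Real.log (n / g))) := by gcongr
          _ = 240 * ((g : ℝ) ^ 2 * Real.log (n / g)) := by ring
          _ ≤ 240 * β := by gcongr
          _ ≤ m := hm
          _ ≤ m * threshold v j := le_mul_of_one_le_right (by positivity) hT1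
      · refine ⟨p, hp, by omega, by simp [hjg], ?_⟩
        have h2p : 2 * (p : ℝ) < j * threshold v j := by exact_mod_cast hgj j hjp (by omega)
        have hβj : (p * j / threshold v j : ℝ) * Real.log (n / j) ≤ β := by
          refine le_trans ?_ (le_superBound hp hj hjp)
          rw [superK_eq hv hj hjp]
          refine mul_le_mul_of_nonneg_right (le_min ?_ ?_) (by linarith)
          · have : (0 : ℝ) ≤ p * j / threshold v j := by positivity
            nlinarith
          · refine le_trans ?_ (le_mul_of_one_le_left (by positivity) hel)
            rw [div_le_iff₀ hT0]
            nlinarith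
        calc 80 * ((p : ℝ) * j) * Real.log (n / j)
            = 80 * ((p * j / threshold v j : ℝ) * Real.log (n / j)) * threshold v j := by
              field_simp
          _ ≤ 80 * β * threshold v j := by gcongr
          _ ≤ m * threshold v j := by gcongr; linarith
    have hw := weight_le hj (show 2 * j ≤ n by omega) hD1 hTD hmD
    have hD0 : (0 : ℝ) < D := by exact_mod_cast hD1
    have hY : 16 * (p * g) = 16 * D * if j ≤ g then p else g := by rw [← hDD]; ring
    have hX : ((16 * (p * g) - threshold v j * if j ≤ g then p else g : ℕ) : ℝ) =
        (1 - threshold v j / (16 * D)) * ((16 * (p * g) : ℕ) : ℝ) := by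
      rw [hY, ← Nat.sub_mul, Nat.cast_mul, Nat.cast_sub hTD]
      push_cast
      field_simp
    rw [hX, mul_pow, ← mul_assoc]
    gcongr
  have hgeom : ∑ j ∈ Icc 1 p, (1 / 2 : ℝ) ^ j < 1 := by
    have : ∀ q : ℕ, ∑ j ∈ Icc 1 q, (1 / 2 : ℝ) ^ j = 1 - (1 / 2) ^ q := by
      intro q
      induction q with
      | zero => simp
      | succ q ih => rw [sum_Icc_succ_top (by omega), ih]; ring
    rw [this]
    have : (0 : ℝ) < (1 / 2) ^ p := by positivity
    linarith
  have hYpos : (0 : ℝ) < ((16 * (p * g) : ℕ) : ℝ) ^ m := by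
    have : 0 < 16 * (p * g) := by positivity
    positivity
  have hsplit : range (p + 1) = insert 0 (Icc 1 p) := by
    ext j; simp only [mem_range, mem_insert, mem_Icc]; omega
  rw [hsplit, sum_insert (by simp)]
  rw [← Nat.cast_lt (α := ℝ)]
  simp only [if_true, mul_zero, zero_add, Nat.cast_sum, Nat.cast_mul]
  rw [Nat.cast_pow]
  calc ∑ j ∈ Icc 1 p, ((n.choose j : ℝ) * ((2 ^ j : ℕ) : ℝ) * ((if j = 0 then 0 else
          (16 * (p * g) - threshold v j * if j ≤ g then p else g) ^ m : ℕ) : ℝ))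
      ≤ ∑ j ∈ Icc 1 p, (1 / 2 : ℝ) ^ j * ((16 * (p * g) : ℕ) : ℝ) ^ m := by
        refine sum_le_sum fun j hj => ?_
        rw [mem_Icc] at hj
        rw [if_neg (by omega), Nat.cast_pow, Nat.cast_pow]
        exact key j hj.1 hj.2
    _ = (∑ j ∈ Icc 1 p, (1 / 2 : ℝ) ^ j) * ((16 * (p * g) : ℕ) : ℝ) ^ m := by rw [sum_mul]
    _ < 1 * ((16 * (p * g) : ℕ) : ℝ) ^ m := by gcongr
    _ = _ := one_mul _

end Size

/-! ### Reasoning about random access machine programs -/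

namespace RAM

@[simp] theorem State.setReg_reg (s : State) (x a y : ℕ) :
    (s.setReg x a).reg y = if y = x then a else s.reg y := by
  simp [State.setReg, Function.update_apply]

@[simp] theorem State.setReg_arr (s : State) (x a : ℕ) : (s.setReg x a).arr = s.arr := rfl

@[simp] theorem State.setArr_reg (s : State) (b i a : ℕ) : (s.setArr b i a).reg = s.reg := rfl

@[simp] theorem State.setArr_arr (s : State) (b i a b' : ℕ) :
    (s.setArr b i a).arr b' = if b' = b then Function.update (s.arr b) i a else s.arr b' := by
  simp [State.setArr, Function.update_apply]

/-- Sequential composition. -/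
infixr:67 " ;; " => RAM.Prog.seq

namespace Prog

/-- The registers that a program may write. -/
def regs : Prog → List ℕ
  | skip => []
  | const x _ => [x]
  | add x _ _ => [x]
  | sub x _ _ => [x]
  | load x _ _ => [x]
  | store _ _ _ => []
  | seq c d => c.regs ++ d.regs
  | branch _ c d => c.regs ++ d.regs
  | loop _ c => c.regs

/-- The arrays that a program may write. -/
def arrs : Prog → List ℕ
  | skip => []
  | const _ _ => []
  | add _ _ _ => []
  | sub _ _ _ => []
  | load _ _ _ => []
  | store b _ _ => [b]
  | seq c d => c.arrs ++ d.arrs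
  | branch _ c d => c.arrs ++ d.arrs
  | loop _ c => c.arrs

/-- The program contains no loop. -/
def loopFree : Prog → Bool
  | seq c d => c.loopFree && d.loopFree
  | branch _ c d => c.loopFree && d.loopFree
  | loop _ _ => false
  | _ => true

/-- The effect of a loop-free program on the memory.  The value on a loop is irrelevant. -/
def eval : Prog → State → State
  | skip, s => s
  | const x a, s => s.setReg x a
  | add x y z, s => s.setReg x (s.reg y + s.reg z)
  | sub x y z, s => s.setReg x (s.reg y - s.reg z)
  | load x b y, s => s.setReg x (s.arr b (s.reg y))
  | store b x y, s => s.setArr b (s.reg x) (s.reg y)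
  | seq c d, s => d.eval (c.eval s)
  | branch x c d, s => if s.reg x = 0 then d.eval s else c.eval s
  | loop _ _, s => s

/-- A bound for the number of steps of a loop-free program. -/
def cost : Prog → ℕ
  | seq c d => c.cost + d.cost
  | branch _ c d => max c.cost d.cost + 1
  | _ => 1

/-- `for i = 0, …, (value of register N) - 1 do c`.  Register `0` serves as a temporary for the
loop test; since it is set anew before each test, the body may overwrite it. -/
def forTo (i N : ℕ) (c : Prog) : Prog :=
  const i 0 ;; sub 0 N i ;; loop 0 (c ;; const 0 1 ;; add i i 0 ;; sub 0 N i)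

/-- `x := y * z`, by repeated addition, with `k` as loop counter. -/
def mul (x y z k : ℕ) : Prog :=
  const x 0 ;; forTo k y (add x x z)

end Prog

open Prog

/-- `t` agrees with `s` on everything that the program `c` does not write. -/
def Agree (c : Prog) (s t : State) : Prop :=
  (∀ x, x ∉ c.regs → t.reg x = s.reg x) ∧ ∀ b, b ∉ c.arrs → t.arr b = s.arr b

theorem Agree.refl (c : Prog) (s : State) : Agree c s s := ⟨fun _ _ => rfl, fun _ _ => rfl⟩

theorem Agree.trans {c : Prog} {s t u : State} (h : Agree c s t) (h' : Agree c t u) :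
    Agree c s u :=
  ⟨fun x hx => (h'.1 x hx).trans (h.1 x hx), fun b hb => (h'.2 b hb).trans (h.2 b hb)⟩

theorem Agree.mono {c d : Prog} {s t : State} (h : Agree c s t)
    (hr : ∀ x ∈ c.regs, x ∈ d.regs) (ha : ∀ x ∈ c.arrs, x ∈ d.arrs) : Agree d s t :=
  ⟨fun x hx => h.1 x fun h' => hx (hr x h'), fun x hx => h.2 x fun h' => hx (ha x h')⟩

/-- The frame rule: an execution changes at most what the program text writes. -/
theorem Exec.agree {c : Prog} {s t : State} {k : ℕ} (h : Exec c s t k) : Agree c s t := by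
  induction h with
  | skip => exact .refl _ _
  | const | add | sub | load =>
    refine ⟨fun y hy => ?_, fun _ _ => rfl⟩
    simp only [regs, List.mem_singleton] at hy
    simp [hy]
  | store =>
    refine ⟨fun _ _ => rfl, fun y hy => ?_⟩
    simp only [arrs, List.mem_singleton] at hy
    simp [hy]
  | seq _ _ ih₁ ih₂ =>
    exact (ih₁.mono (by simp +contextual [regs]) (by simp +contextual [arrs])).trans
      (ih₂.mono (by simp +contextual [regs]) (by simp +contextual [arrs]))
  | branch_pos _ _ ih | branch_zero _ _ ih =>
    exact ih.mono (by simp +contextual [regs]) (by simp +contextual [arrs])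
  | loop_zero => exact .refl _ _
  | loop_pos _ _ _ ih₁ ih₂ => exact Agree.trans (ih₁.mono (fun _ h => h) (fun _ h => h)) ih₂

/-- Total correctness with a time bound: started in `s`, the program `c` halts after at most `T`
steps, in a state that satisfies `Q`. -/
def Reach (c : Prog) (s : State) (T : ℕ) (Q : State → Prop) : Prop :=
  ∃ t k, Exec c s t k ∧ k ≤ T ∧ Q t

theorem Reach.mono {c : Prog} {s : State} {T T' : ℕ} {Q Q' : State → Prop} (h : Reach c s T Q)
    (hT : T ≤ T') (hQ : ∀ t, Agree c s t → Q t → Q' t) : Reach c s T' Q' := by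
  obtain ⟨t, k, he, hk, hq⟩ := h
  exact ⟨t, k, he, hk.trans hT, hQ t he.agree hq⟩

theorem Reach.seq {c d : Prog} {s : State} {T₁ T₂ : ℕ} {Q : State → Prop}
    (h : Reach c s T₁ fun t => Reach d t T₂ Q) : Reach (c ;; d) s (T₁ + T₂) Q := by
  obtain ⟨t, k, he, hk, u, l, he', hl, hq⟩ := h
  exact ⟨u, k + l, .seq he he', by omega, hq⟩

theorem Reach.then {c d : Prog} {s : State} {T₁ T₂ : ℕ} {P Q : State → Prop}
    (h : Reach c s T₁ P) (h' : ∀ t, Agree c s t → P t → Reach d t T₂ Q) :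
    Reach (c ;; d) s (T₁ + T₂) Q :=
  .seq (h.mono le_rfl h')

theorem Reach.branch {x : ℕ} {c d : Prog} {s : State} {T : ℕ} {Q : State → Prop}
    (h : s.reg x ≠ 0 → Reach c s T Q) (h' : s.reg x = 0 → Reach d s T Q) :
    Reach (branch x c d) s (T + 1) Q := by
  by_cases hx : s.reg x = 0
  · obtain ⟨t, k, he, hk, hq⟩ := h' hx
    exact ⟨t, k + 1, .branch_zero hx he, by omega, hq⟩
  · obtain ⟨t, k, he, hk, hq⟩ := h hx
    exact ⟨t, k + 1, .branch_pos hx he, by omega, hq⟩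

/-- A loop-free program is run by evaluating it. -/
theorem Reach.flat {c : Prog} {s : State} {T : ℕ} {Q : State → Prop} (hc : c.loopFree = true)
    (hT : c.cost ≤ T) (hQ : Q (c.eval s)) : Reach c s T Q := by
  suffices h : ∀ s, Reach c s c.cost fun t => t = c.eval s from
    (h s).mono hT (by rintro t - rfl; exact hQ)
  clear hQ hT Q T s
  induction c with
  | skip => exact fun s => ⟨_, _, .skip s, le_rfl, rfl⟩
  | const x a => exact fun s => ⟨_, _, .const s x a, le_rfl, rfl⟩
  | add x y z => exact fun s => ⟨_, _, .add s x y z, le_rfl, rfl⟩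
  | sub x y z => exact fun s => ⟨_, _, .sub s x y z, le_rfl, rfl⟩
  | load x b y => exact fun s => ⟨_, _, .load s x b y, le_rfl, rfl⟩
  | store b x y => exact fun s => ⟨_, _, .store s b x y, le_rfl, rfl⟩
  | seq c d ih₁ ih₂ =>
    intro s
    simp only [loopFree, Bool.and_eq_true] at hc
    refine (ih₁ hc.1 s).then ?_
    rintro t - rfl
    exact ih₂ hc.2 _
  | branch x c d ih₁ ih₂ =>
    intro s
    simp only [loopFree, Bool.and_eq_true] at hc
    refine Reach.branch (fun hx => (ih₁ hc.1 s).mono (le_max_left _ _) ?_)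
      (fun hx => (ih₂ hc.2 s).mono (le_max_right _ _) ?_)
    · rintro t - rfl; simp [eval, hx]
    · rintro t - rfl; simp [eval, hx]
  | loop => simp [loopFree] at hc

/-- Loops that go round a known number of times: the loop test succeeds in rounds `0, …, n - 1`
and fails in round `n`. -/
theorem Reach.loop {x : ℕ} {c : Prog} {n T : ℕ} {Inv : ℕ → State → Prop} {s : State}
    (h0 : Inv 0 s)
    (hpos : ∀ k < n, ∀ t, Agree c s t → Inv k t → t.reg x ≠ 0 ∧ Reach c t T (Inv (k + 1)))
    (hzero : ∀ t, Agree c s t → Inv n t → t.reg x = 0) :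
    Reach (loop x c) s (n * (T + 1) + 1) (Inv n) := by
  suffices h : ∀ j k, k + j = n → ∀ t, Agree c s t → Inv k t →
      Reach (.loop x c) t (j * (T + 1) + 1) (Inv n) from h n 0 (by omega) s (.refl _ _) h0
  intro j
  induction j with
  | zero =>
    rintro k hk t hst ht
    obtain rfl : k = n := by omega
    exact ⟨t, 1, .loop_zero (hzero t hst ht), by omega, ht⟩
  | succ j ih =>
    intro k hk t hst ht
    obtain ⟨hx, u, l, he, hl, hu⟩ := hpos k (by omega) t hst ht
    obtain ⟨w, l', he', hl', hw⟩ := ih (k + 1) (by omega) u (hst.trans he.agree) hu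
    refine ⟨w, _, .loop_pos hx he he', ?_, hw⟩
    rw [Nat.succ_mul]
    omega

/-- The rule for counted loops.  The states in which the invariant is required are those after the
counter has been increased and the loop test has been computed in register `0`. -/
theorem Reach.forTo {i N : ℕ} {c : Prog} {n T : ℕ} (Inv : ℕ → State → Prop) {s : State}
    (hN : s.reg N = n) (hi : (i ≠ 0 ∧ N ≠ 0 ∧ i ≠ N ∧ i ∉ c.regs) ∧ N ∉ c.regs)
    (h0 : Inv 0 ((s.setReg i 0).setReg 0 n))
    (hstep : ∀ k < n, ∀ t, Agree (forTo i N c) s t → t.reg i = k → Inv k t →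
      Reach c t T fun u => Inv (k + 1) (((u.setReg 0 1).setReg i (k + 1)).setReg 0 (n - (k + 1)))) :
    Reach (forTo i N c) s (n * (T + 4) + 3) (Inv n) := by
  obtain ⟨⟨hi0, hN0, hiN, hic⟩, hNc⟩ := hi
  have hNi : N ≠ i := hiN.symm
  let s' := (s.setReg i 0).setReg 0 n
  let Inv' : ℕ → State → Prop := fun k t => Inv k t ∧ t.reg i = k ∧ t.reg 0 = n - k
  have hs' : Agree (Prog.forTo i N c) s s' := by
    refine ⟨fun x hx => ?_, fun _ _ => rfl⟩
    simp only [Prog.forTo, regs, List.mem_append, List.mem_singleton, not_or] at hx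
    simp [s', hx.1, hx.2.1]
  suffices h : Reach (.loop 0 (c ;; .const 0 1 ;; .add i i 0 ;; .sub 0 N i)) s'
      (n * (T + 3 + 1) + 1) (Inv' n) by
    obtain ⟨t, k, he, hk, hq⟩ := h
    refine ⟨t, 1 + (1 + k), .seq (.const _ _ _) (.seq (.sub _ _ _ _) ?_), ?_, hq.1⟩
    · have e : (s.setReg i 0).reg N - (s.setReg i 0).reg i = n := by simp [hNi, hN]
      rw [e]; exact he
    · have : T + 3 + 1 = T + 4 := rfl
      rw [this] at hk; omega
  refine Reach.loop ⟨h0, by simp [s', hi0], by simp [s']⟩ ?_ ?_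
  · rintro k hk t hst ⟨hI, hti, ht0⟩
    refine ⟨by omega, ?_⟩
    have hst' : Agree (Prog.forTo i N c) s t := by
      refine hs'.trans (hst.mono ?_ ?_)
      · intro x hx; simp only [Prog.forTo, regs, List.mem_append, List.mem_singleton] at hx ⊢; tauto
      · intro x hx; simp only [Prog.forTo, arrs, List.mem_append] at hx ⊢; tauto
    obtain ⟨u, l, he, hl, hu⟩ := hstep k hk t hst' hti hI
    have hui : u.reg i = k := by rw [he.agree.1 i hic, hti]
    have huN : u.reg N = n := by
      rw [he.agree.1 N hNc, hst.1 N, ← hN]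
      · simp [s', hNi, hN0]
      · simp [regs, hNc, hNi, hN0]
    refine ⟨_, l + (1 + (1 + 1)), .seq he (.seq (.const _ _ _) (.seq (.add _ _ _ _) (.sub _ _ _ _))),
      by omega, ?_⟩
    have e1 : (u.setReg 0 1).reg i + (u.setReg 0 1).reg 0 = k + 1 := by simp [hi0, hui]
    have e2 : ((u.setReg 0 1).setReg i (k + 1)).reg N - ((u.setReg 0 1).setReg i (k + 1)).reg i
        = n - (k + 1) := by simp [hNi, hN0, huN]
    rw [e1, e2]
    exact ⟨hu, by simp [hi0], by simp⟩
  · rintro t - ⟨-, -, h⟩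
    simpa using h

theorem reach_mul {x y z k : ℕ} {s : State} {a b : ℕ} (hy : s.reg y = a) (hz : s.reg z = b)
    (h : (k ≠ 0 ∧ y ≠ 0 ∧ k ≠ y ∧ k ≠ x ∧ x ≠ 0) ∧ y ≠ x ∧ z ≠ 0 ∧ z ≠ k ∧ z ≠ x) :
    Reach (mul x y z k) s (a * 5 + 4) fun t => t.reg x = a * b := by
  obtain ⟨⟨hk0, hy0, hky, hkx, hx0⟩, hyx, hz0, hzk, hzx⟩ := h
  have : a * 5 + 4 = 1 + (a * (1 + 4) + 3) := by ring
  rw [this]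
  refine (Reach.flat (Q := fun t => t = s.setReg x 0) rfl le_rfl rfl).then ?_
  rintro t - rfl
  refine Reach.forTo (fun i t => t.reg x = i * b) (by simp [hyx, hy])
    (by simp [regs, hk0, hy0, hky, hkx, hyx]) (by simp [hkx.symm, hx0]) ?_
  intro i hi t hst hti hI
  refine Reach.flat rfl le_rfl ?_
  have : t.reg z = b := by
    rw [hst.1 z (by simp [regs, Prog.forTo, hz0, hzk, hzx])]; simp [hzx, hz]
  simp [eval, hkx.symm, hx0, hI, this]; ring

end RAM

/-! ### The program -/

namespace RAM

/-! Names of the registers: `rN`, `rP`, `rP1`, `rL` hold `n`, `p`, `p + 1`, `2 n + 1`; `rG` the pivot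
`g`; `rY` the number `Y = 16 p g`; `rE` the number of events; `rM` the number of rows; `rBase` the
position in `aW` of the current powers `X_j ^ r`; `rPow` the power `Y ^ m`; `rSum` the weight of the
row evaluated last; `rBest` the weight of the best row; `rOut` the next output cell; `rCond` the test
of the search for `m`. The loop counters are `rX` (columns), `rJ` (cardinalities), `rEv` (events),
`rK` (multiplication), `rRound` (rows) and `rQ`, `rB`, `rA`, `rS` (the parameters `Q, B, a, b` of a
row of the pool); `rH` is the hash value, `rCur` the number of events before the current round, and
`rU`, `rV`, `rW`, `rZ` are temporaries, as is register `0`.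

Names of the arrays: `aT` and `aX` hold `T_j` and `X_j`, `aW` the powers of `X_j`; event number `e` has
parent `aPar[e]`, last column `aElt[e]`, label `aLab[e]` (whether this column is in `T`) and
cardinalities `aSize[e] = |S|`, `aTsz[e] = |T|`; `aLive` and `aNew` mark the events not hit before and
after the row evaluated last, and `aS`, `aC` hold the number of entries `1` of this row on `S` and `T`;
`aRow` and `aBest` are the current and the best row. -/

notation "rN" => (1 : ℕ)
notation "rP" => (2 : ℕ)
notation "rG" => (3 : ℕ)
notation "rY" => (4 : ℕ)
notation "rE" => (5 : ℕ)
notation "rM" => (6 : ℕ)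
notation "rBase" => (7 : ℕ)
notation "rP1" => (8 : ℕ)
notation "rPow" => (9 : ℕ)
notation "rSum" => (10 : ℕ)
notation "rBest" => (11 : ℕ)
notation "rOut" => (12 : ℕ)
notation "rCond" => (13 : ℕ)
notation "rX" => (14 : ℕ)
notation "rJ" => (15 : ℕ)
notation "rEv" => (16 : ℕ)
notation "rK" => (17 : ℕ)
notation "rRound" => (18 : ℕ)
notation "rQ" => (19 : ℕ)
notation "rB" => (20 : ℕ)
notation "rA" => (21 : ℕ)
notation "rS" => (22 : ℕ)
notation "rL" => (23 : ℕ)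
notation "rH" => (24 : ℕ)
notation "rU" => (25 : ℕ)
notation "rV" => (26 : ℕ)
notation "rW" => (27 : ℕ)
notation "rZ" => (28 : ℕ)
notation "rCur" => (29 : ℕ)
notation "aIn" => (0 : ℕ)
notation "aOut" => (1 : ℕ)
notation "aT" => (2 : ℕ)
notation "aX" => (3 : ℕ)
notation "aW" => (4 : ℕ)
notation "aPar" => (5 : ℕ)
notation "aElt" => (6 : ℕ)
notation "aLab" => (7 : ℕ)
notation "aSize" => (8 : ℕ)
notation "aTsz" => (9 : ℕ)
notation "aLive" => (10 : ℕ)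
notation "aNew" => (11 : ℕ)
notation "aS" => (12 : ℕ)
notation "aC" => (13 : ℕ)
notation "aRow" => (14 : ℕ)
notation "aBest" => (15 : ℕ)

open Prog

/-- Read the input: `rN := n`, `rP := p`; also `rP1 := p + 1` and `rL := 2 n + 1`. -/
def readInput : Prog :=
  const 0 0 ;; load rN aIn 0 ;; const 0 1 ;; load rP aIn 0 ;; add rP1 rP 0 ;;
  add rL rN rN ;; add rL rL 0

/-- Write the `n × n` identity matrix. -/
def writeIdentity : Prog :=
  const 0 0 ;; store aOut 0 rN ;; const rOut 1 ;;
  forTo rRound rN (forTo rX rN (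
    sub rU rRound rX ;; sub rV rX rRound ;; add rU rU rV ;; const rW 1 ;; sub rW rW rU ;;
    store aOut rOut rW ;; const 0 1 ;; add rOut rOut 0))

/-- `aT[j] := j + 1 - v_j` for `1 ≤ j ≤ p`, and `aT[0] := 1`. -/
def thresholds : Prog :=
  forTo rJ rP1 (const 0 1 ;; add rU rJ 0 ;; load rV aIn rU ;; sub rU rU rV ;;
    store aT rJ rU) ;;
  const 0 0 ;; const rU 1 ;; store aT 0 rU

/-- `rG :=` the largest `j ≤ p` with `j * aT[j] ≤ 2 p`. -/
def findPivot : Prog :=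
  forTo rJ rP1 (load rU aT rJ ;; mul rV rJ rU rK ;; sub rV rV rP ;; sub rV rV rP ;;
    branch rV skip (const 0 0 ;; add rG rJ 0))

/-- `rY := 16 p g`, `aX[j] := 16 p g - aT[j] * (if j ≤ g then p else g)`, and the powers with
exponent zero `aW[j] := 1`. -/
def rates : Prog :=
  mul rY rP rG rK ;; add rY rY rY ;; add rY rY rY ;; add rY rY rY ;; add rY rY rY ;;
  forTo rJ rP1 (
    const 0 0 ;; sub rV rJ rG ;; branch rV (add rU rG 0) (add rU rP 0) ;;
    load rW aT rJ ;; mul rV rW rU rK ;; sub rV rY rV ;; store aX rJ rV ;;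
    const rV 1 ;; store aW rJ rV)

/-- Append to the table of events the extension of event number `rEv` by the element `rX`,
with label `lab`. -/
def appendEvent (lab : ℕ) : Prog :=
  const 0 1 ;; store aPar rE rEv ;; store aElt rE rX ;; const rU lab ;; store aLab rE rU ;;
  load rV aSize rEv ;; add rV rV 0 ;; store aSize rE rV ;;
  load rV aTsz rEv ;; add rV rV rU ;; store aTsz rE rV ;; add rE rE 0

/-- Build the table of events. -/
def listEvents : Prog :=
  const rE 1 ;;
  forTo rX rN (const 0 0 ;; add rCur rE 0 ;; forTo rEv rCur (
    load rU aSize rEv ;; sub rU rP rU ;; branch rU (appendEvent 0 ;; appendEvent 1) skip))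

/-- Mark as alive the relevant events `(S, T)`, those with `|T| = T_j` for `j = |S|`. -/
def markRelevant : Prog :=
  forTo rEv rE (load rU aSize rEv ;; load rU aT rU ;; load rV aTsz rEv ;; sub rW rU rV ;;
    sub rV rV rU ;; add rV rV rW ;; const rW 1 ;; sub rW rW rV ;; store aLive rEv rW)

/-- Evaluate the row `aRow`: `aNew` marks the events that are alive and not hit by the row, and
`rSum` is the sum of their weights.  The row hits `(S, T)` if the truncated differences
`aS[e] - 1` and `1 - aC[e]` both vanish, since `aC[e] ≤ aS[e]`.  The cells `aS[0]` and `aC[0]`, which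
belong to the event `(∅, ∅)`, are never written and have to be zero. -/
def evalRow : Prog :=
  const rSum 0 ;; forTo rEv rE (
    branch rEv
      (load rU aPar rEv ;; load rV aElt rEv ;; load rV aRow rV ;;
        load rW aS rU ;; add rW rW rV ;; store aS rEv rW ;;
        load rW aC rU ;; load rZ aLab rEv ;; branch rZ (add rW rW rV) skip ;; store aC rEv rW)
      skip ;;
    load rU aLive rEv ;;
    branch rU
      (load rV aS rEv ;; const 0 1 ;; sub rV rV 0 ;; load rW aC rEv ;; sub rW 0 rW ;;
        add rV rV rW ;;
        branch rV
          (const rU 1 ;; load rV aSize rEv ;; add rV rV rBase ;; load rV aW rV ;;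
            add rSum rSum rV)
          (const rU 0))
      skip ;;
    store aNew rEv rU)

/-- Append the next level of powers: from `aW[base + j] = X_j ^ m` compute
`aW[base + (p + 1) + j] = X_j ^ (m + 1)`; update `rPow` and `rM` accordingly. -/
def nextPowers : Prog :=
  forTo rJ rP1 (add rU rBase rJ ;; load rV aW rU ;; load rW aX rJ ;; mul rZ rW rV rK ;;
    add rU rU rP1 ;; store aW rU rZ) ;;
  add rBase rBase rP1 ;; mul rU rY rPow rK ;; const 0 0 ;; add rPow rU 0 ;;
  const 0 1 ;; add rM rM 0

/-- Set `rCond` to a nonzero value exactly if the total weight of the events is at least `Y ^ m`.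
This evaluates `aRow` as it is before any row has been computed, the zero row, which hits nothing. -/
def testSize : Prog :=
  evalRow ;; const 0 1 ;; add rCond rSum 0 ;; sub rCond rCond rPow

/-- Find the least `m` for which the total weight `∑ X_j ^ m` of the relevant events is less than
`Y ^ m`. -/
def findSize : Prog :=
  const rPow 1 ;; testSize ;; loop rCond (nextPowers ;; testSize)

/-- Make the current row the best row so far. -/
def copyBest : Prog :=
  const 0 0 ;; add rBest rSum 0 ;; forTo rX rN (load rU aRow rX ;; store aBest rX rU)

/-- Write into `aRow` the row with entry `1` in column `x` if `(a x + b) mod Q < B`. -/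
def hashRow : Prog :=
  const 0 0 ;; add rH rS 0 ;; forTo rX rN (
    sub rU rB rH ;; branch rU (const rU 1) skip ;; store aRow rX rU ;;
    add rH rH rA ;; const 0 1 ;; add rU rH 0 ;; sub rU rU rQ ;;
    branch rU (sub rH rH rQ) skip)

/-- Compare a row from the pool with the best row so far. -/
def tryRow : Prog :=
  hashRow ;; evalRow ;; sub rU rBest rSum ;; branch rU copyBest skip

/-- Find the best row in the pool. -/
def bestRow : Prog :=
  evalRow ;; copyBest ;; forTo rQ rL (forTo rB rL (forTo rA rL (forTo rS rL tryRow)))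

/-- Append the best row to the output, and declare dead the events that it hits. -/
def takeBest : Prog :=
  forTo rX rN (load rU aBest rX ;; store aRow rX rU ;; store aOut rOut rU ;; const 0 1 ;;
    add rOut rOut 0) ;;
  evalRow ;; forTo rEv rE (load rU aNew rEv ;; store aLive rEv rU)

/-- Choose the `m` rows greedily. -/
def greedy : Prog :=
  const rOut 1 ;; const 0 0 ;; store aOut 0 rM ;;
  forTo rRound rM (sub rBase rBase rP1 ;; bestRow ;; takeBest)

/-- The whole program. -/
def superselector : Prog :=
  readInput ;; add rU rP rP ;; sub rU rU rN ;;
  branch rU writeIdentity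
    (thresholds ;; findPivot ;; rates ;; listEvents ;; markRelevant ;; findSize ;; greedy)

end RAM

/-! ### Correctness of the preparatory parts -/

namespace RAM
open Prog

theorem reach_readInput {n p : ℕ} {v : ℕ → ℕ} :
    Reach readInput (input n p v) 7 fun t =>
      t.reg rN = n ∧ t.reg rP = p ∧ t.reg rP1 = p + 1 ∧ t.reg rL = 2 * n + 1 := by
  refine Reach.flat rfl (by decide) ?_
  simp [readInput, eval, input]; omega

theorem mul_add_inj {n r c k l : ℕ} (hc : c < n) (hl : l < n) (h : r * n + c = k * n + l) :
    r = k ∧ c = l := by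
  have h2 : (r * n + c) % n = (k * n + l) % n := by rw [h]
  rw [mul_comm r, mul_comm k, Nat.mul_add_mod, Nat.mul_add_mod, Nat.mod_eq_of_lt hc,
    Nat.mod_eq_of_lt hl] at h2
  exact ⟨Nat.eq_of_mul_eq_mul_right (Nat.zero_lt_of_lt hc) (by omega), h2⟩

theorem reach_writeIdentity {n : ℕ} {s : State} (hn : s.reg rN = n) :
    Reach writeIdentity s (n * (n * 12 + 7) + 6) fun t =>
      t.arr aOut 0 = n ∧ ∀ r < n, ∀ c < n, t.arr aOut (1 + r * n + c) = if r = c then 1 else 0 := by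
  let Inv : ℕ → State → Prop := fun k t => t.reg rOut = 1 + k ∧ t.arr aOut 0 = n ∧
    ∀ r c, c < n → r * n + c < k → t.arr aOut (1 + r * n + c) = if r = c then 1 else 0
  rw [show n * (n * 12 + 7) + 6 = 1 + (1 + (1 + (n * ((n * (8 + 4) + 3) + 4) + 3))) by ring]
  refine .seq (.flat rfl le_rfl (.seq (.flat rfl le_rfl (.seq (.flat rfl le_rfl ?_)))))
  refine (Reach.forTo (fun k => Inv (k * n)) (by simp [eval, hn]) (by decide)
    (by simp [Inv, eval, hn]) ?_).mono le_rfl ?_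
  · intro k hk t ht htk hI
    have htn : t.reg rN = n := by rw [ht.1 _ (by decide)]; simp [eval, hn]
    refine (Reach.forTo (fun l => Inv (k * n + l)) htn (by decide) (by simpa [Inv] using hI)
      ?_).mono le_rfl ?_
    · rintro l hl u hu hul ⟨h1, h2, h3⟩
      have huk : u.reg rRound = k := by rw [hu.1 _ (by decide), htk]
      refine Reach.flat rfl (by decide) ?_
      simp only [eval, State.setReg_reg, State.setArr_reg, State.setReg_arr, State.setArr_arr, Inv,
        h1, huk, hul, if_true, Nat.reduceEqDiff, if_false, OfNat.ofNat_ne_zero,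
        OfNat.zero_ne_ofNat]
      refine ⟨by omega, by rw [Function.update_of_ne (by omega), h2], ?_⟩
      intro r c hc hrc
      by_cases h : r * n + c = k * n + l
      · obtain ⟨rfl, rfl⟩ := mul_add_inj hc hl h
        rw [show 1 + r * n + c = 1 + (r * n + c) by ring, Function.update_self]
        split_ifs <;> omega
      · rw [Function.update_of_ne (by omega)]
        exact h3 r c hc (by omega)
    · intro u hu h
      simpa [Inv, Nat.succ_mul] using h
  · rintro t - ⟨-, h2, h3⟩
    refine ⟨h2, fun r hr c hc => h3 r c hc ?_⟩
    calc r * n + c < (r + 1) * n := by rw [Nat.succ_mul]; omega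
      _ ≤ n * n := Nat.mul_le_mul_right _ hr

theorem reach_thresholds {p : ℕ} {v : ℕ → ℕ} {s : State} (hp : s.reg rP1 = p + 1)
    (hv : ∀ j, 1 ≤ j → j ≤ p → s.arr aIn (j + 1) = v j) :
    Reach thresholds s ((p + 1) * 9 + 6) fun t => ∀ j ≤ p, t.arr aT j = threshold v j := by
  rw [show (p + 1) * 9 + 6 = ((p + 1) * (5 + 4) + 3) + 3 by ring]
  refine (Reach.forTo (fun k t => ∀ j, 1 ≤ j → j < k → t.arr aT j = threshold v j) hp (by decide)
    (by simp) ?_).then ?_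
  · intro k hk t ht htk hI
    refine Reach.flat rfl (by decide) ?_
    have hin : t.arr aIn = s.arr aIn := ht.2 _ (by decide)
    simp [eval, htk, hin]
    intro j hj1 hjk
    by_cases h : j = k
    · subst h
      simp [hv j hj1 (by omega), threshold, show j ≠ 0 by omega]
    · simp [h, hI j hj1 (by omega)]
  · intro t ht hI
    refine Reach.flat rfl (by decide) ?_
    simp [eval]
    intro j hj
    by_cases h : j = 0
    · simp [h, threshold]
    · simp [h, hI j (by omega) (by omega)]

theorem reach_findPivot {p : ℕ} {τ : ℕ → ℕ} {s : State} (hP : s.reg rP = p)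
    (hp : s.reg rP1 = p + 1) (hτ : ∀ j ≤ p, s.arr aT j = τ j) :
    Reach findPivot s ((p + 1) * (p * 5 + 14) + 3) fun t =>
      t.reg rG ≤ p ∧ t.reg rG * τ (t.reg rG) ≤ 2 * p ∧
        ∀ j ≤ p, t.reg rG < j → 2 * p < j * τ j := by
  rw [show (p + 1) * (p * 5 + 14) + 3 = (p + 1) * ((1 + ((p * 5 + 4) + 5)) + 4) + 3 by ring]
  refine (Reach.forTo (fun k t => 0 < k → t.reg rG < k ∧ t.reg rG * τ (t.reg rG) ≤ 2 * p ∧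
        ∀ j < k, t.reg rG < j → 2 * p < j * τ j) hp (by decide)
    (by simp) ?_).mono le_rfl ?_
  · intro k hk t ht htk hI
    have hT : t.arr aT = s.arr aT := ht.2 _ (by decide)
    have htP : t.reg rP = p := by rw [ht.1 _ (by decide), hP]
    refine .seq (.flat rfl le_rfl ?_)
    refine ((reach_mul (a := k) (b := τ k) (by simp [eval, htk])
      (by simp [eval, htk, hT, hτ k (by omega)]) (by decide)).mono
        (by omega : _ ≤ p * 5 + 4) fun _ _ h => h).then ?_
    intro u hu huV
    have huk : u.reg rJ = k := by rw [hu.1 _ (by decide)]; simp [eval, htk]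
    have huP : u.reg rP = p := by rw [hu.1 _ (by decide)]; simp [eval, htP]
    have huG : u.reg rG = t.reg rG := by rw [hu.1 _ (by decide)]; simp [eval]
    refine Reach.flat rfl (by decide) ?_
    by_cases h : k * τ k ≤ 2 * p
    · simp [eval, huV, huP, huk, show k * τ k - p - p = 0 by omega, h]
      intros; omega
    · have hk0 : k ≠ 0 := by rintro rfl; simp at h
      obtain ⟨h1, h2, h3⟩ := hI (by omega)
      simp [eval, huV, huP, show ¬ k * τ k - p - p = 0 by omega, huG, h2]
      refine ⟨by omega, ?_⟩
      intro j hj hgj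
      rcases Nat.lt_or_eq_of_le hj with hj | rfl
      · exact h3 j hj hgj
      · omega
  · intro t ht hI
    obtain ⟨h1, h2, h3⟩ := hI (by omega)
    exact ⟨by omega, h2, fun j hj => h3 j (by omega)⟩

theorem reach_rates {p g : ℕ} {τ : ℕ → ℕ} {s : State} (hP : s.reg rP = p) (hG : s.reg rG = g)
    (hp : s.reg rP1 = p + 1) (hτ : ∀ j ≤ p, s.arr aT j = τ j) (hle : ∀ j ≤ p, τ j ≤ j + 1) :
    Reach rates s ((p + 1) * ((p + 1) * 5 + 17) + p * 5 + 11) fun t =>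
      t.reg rY = 16 * (p * g) ∧
        ∀ j ≤ p, t.arr aX j = 16 * (p * g) - τ j * (if j ≤ g then p else g) ∧
          t.arr aW j = 1 := by
  rw [show (p + 1) * ((p + 1) * 5 + 17) + p * 5 + 11 = (p * 5 + 4) + (1 + (1 + (1 + (1 +
    ((p + 1) * ((1 + (1 + (2 + (1 + (((p + 1) * 5 + 4) + 4))))) + 4) + 3))))) by ring]
  refine (reach_mul (a := p) (b := g) hP hG (by decide)).then ?_
  intro t ht htY
  refine .seq (.flat rfl le_rfl (.seq (.flat rfl le_rfl (.seq (.flat rfl le_rfl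
    (.seq (.flat rfl le_rfl ?_)))))))
  set t' := eval (.add rY rY rY) _
  have htY' : t'.reg rY = 16 * (p * g) := by
    simp [t', eval, htY]; ring
  have hag : Agree (mul rY rP rG rK) s t' := by
    refine ht.trans ⟨fun x hx => ?_, fun _ _ => rfl⟩
    have : x ≠ rY := by rintro rfl; exact hx (by decide)
    simp [t', eval, this]
  have hP' : t'.reg rP = p := by rw [hag.1 _ (by decide), hP]
  have hG' : t'.reg rG = g := by rw [hag.1 _ (by decide), hG]
  refine (Reach.forTo (fun k t => t.reg rY = 16 * (p * g) ∧
        ∀ j < k, t.arr aX j = 16 * (p * g) - τ j * (if j ≤ g then p else g) ∧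
          t.arr aW j = 1) (by rw [hag.1 _ (by decide), hp]) (by decide) (by simp [htY'])
      ?_).mono le_rfl ?_
  · rintro k hk u hu huk ⟨hI1, hI2⟩
    have hT : u.arr aT = s.arr aT := by rw [hu.2 _ (by decide), hag.2 _ (by decide)]
    have huP : u.reg rP = p := by rw [hu.1 _ (by decide), hP']
    have huG : u.reg rG = g := by rw [hu.1 _ (by decide), hG']
    refine .seq (.flat rfl le_rfl (.seq (.flat rfl le_rfl (.seq (.flat rfl (by decide)
      (.seq (.flat rfl le_rfl ?_)))))))
    set w := eval (.load rW aT rJ) _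
    have hwU : w.reg rU = if k ≤ g then p else g := by
      by_cases h : k ≤ g
      · simp [w, eval, huk, huG, huP, h, show k - g = 0 by omega]
      · simp [w, eval, huk, huG, h, show ¬ k - g = 0 by omega]
    have hwW : w.reg rW = τ k := by
      by_cases h : k ≤ g
      · simp [w, eval, huk, huG, show k - g = 0 by omega, hT, hτ k (by omega)]
      · simp [w, eval, huk, huG, show ¬ k - g = 0 by omega, hT, hτ k (by omega)]
    have hwr : ∀ x, x ≠ 0 → x ≠ rU → x ≠ rV → x ≠ rW → w.reg x = u.reg x := by
      intro x h0 h1 h2 h3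
      by_cases h : k ≤ g
      · simp [w, eval, huk, huG, show k - g = 0 by omega, h0, h1, h2, h3]
      · simp [w, eval, huk, huG, show ¬ k - g = 0 by omega, h0, h1, h2, h3]
    have hwa : w.arr = u.arr := by
      by_cases h : k ≤ g
      · simp [w, eval, huk, huG, show k - g = 0 by omega]
      · simp [w, eval, huk, huG, show ¬ k - g = 0 by omega]
    refine ((reach_mul hwW hwU (by decide)).mono
      (show _ ≤ (p + 1) * 5 + 4 by have := hle k (by omega); omega) fun _ _ h => h).then ?_
    intro z hz hzV
    have hzY : z.reg rY = 16 * (p * g) := by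
      rw [hz.1 _ (by decide), hwr _ (by decide) (by decide) (by decide) (by decide), hI1]
    have hzJ : z.reg rJ = k := by
      rw [hz.1 _ (by decide), hwr _ (by decide) (by decide) (by decide) (by decide), huk]
    have hzX : z.arr aX = u.arr aX := by rw [hz.2 _ (by decide), hwa]
    have hzW : z.arr aW = u.arr aW := by rw [hz.2 _ (by decide), hwa]
    refine Reach.flat rfl (by decide) ?_
    simp [eval, hzV, hzY, hzJ, hzX, hzW]
    intro j hj
    by_cases h : j = k
    · simp [h]
    · simpa [h] using hI2 j (by omega)
  · rintro u - ⟨h1, h2⟩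
    exact ⟨h1, fun j hj => h2 j (by omega)⟩

end RAM

/-! ### The table of events and the evaluation of a row -/

/-- The event number `e` of a list; numbers beyond the length give `(∅, ∅)`. -/
def evAt (L : List Event) (e : ℕ) : Event := L.getD e (∅, ∅)

theorem evAt_append_left {L L' : List Event} {e : ℕ} (h : e < L.length) :
    evAt (L ++ L') e = evAt L e := by
  simp [evAt, List.getD, List.getElem?_append_left h]

theorem evAt_append_length (L : List Event) (a : Event) : evAt (L ++ [a]) L.length = a := by
  simp [evAt, List.getD]

theorem evAt_mem {L : List Event} {e : ℕ} (h : e < L.length) : evAt L e ∈ L := by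
  simp [evAt, List.getD, List.getElem?_eq_getElem h]

theorem length_eventList_mono (p : ℕ) : Monotone fun n => (eventList p n).length :=
  monotone_nat_of_le_succ fun n => by simp [eventList]

namespace RAM
open Prog

/-- The memory holds the table of the events in `L`: cardinalities, and for each event but the
first (which is `(∅, ∅)`) the number of an earlier event and the element by which it extends that
event; the label says whether the element is in `T`. -/
structure EventTable (L : List Event) (s : State) : Prop where
  length : s.reg rE = L.length
  pos : 0 < L.length
  root : evAt L 0 = (∅, ∅)
  subset : ∀ e < L.length, (evAt L e).2 ⊆ (evAt L e).1
  size : ∀ e < L.length, s.arr aSize e = (evAt L e).1.card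
  tsize : ∀ e < L.length, s.arr aTsz e = (evAt L e).2.card
  parent_lt : ∀ e < L.length, e ≠ 0 → s.arr aPar e < e
  notMem : ∀ e < L.length, e ≠ 0 → s.arr aElt e ∉ (evAt L (s.arr aPar e)).1
  step : ∀ e < L.length, e ≠ 0 → evAt L e = (insert (s.arr aElt e) (evAt L (s.arr aPar e)).1,
    if s.arr aLab e = 0 then (evAt L (s.arr aPar e)).2
    else insert (s.arr aElt e) (evAt L (s.arr aPar e)).2)

theorem EventTable.congr {L : List Event} {s t : State} (h : EventTable L s)
    (hr : t.reg rE = s.reg rE) (ha : ∀ b ∈ [aPar, aElt, aLab, aSize, aTsz], t.arr b = s.arr b) :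
    EventTable L t := by
  simp only [List.mem_cons, List.not_mem_nil, or_false, forall_eq_or_imp, forall_eq] at ha
  obtain ⟨h5, h6, h7, h8, h9⟩ := ha
  obtain ⟨h1, h2, h3, h4, h5', h6', h7', h8', h9'⟩ := h
  exact ⟨by rw [hr, h1], h2, h3, h4, by rwa [h8], by rwa [h9], by rwa [h5], by rwa [h5, h6],
    by rwa [h5, h6, h7]⟩

theorem EventTable.agree {L : List Event} {c : Prog} {s t : State} (h : EventTable L s)
    (ha : Agree c s t)
    (hc : rE ∉ c.regs ∧ ∀ b ∈ [aPar, aElt, aLab, aSize, aTsz], b ∉ c.arrs) : EventTable L t :=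
  h.congr (ha.1 _ hc.1) fun b hb => ha.2 b (hc.2 b hb)

theorem reach_appendEvent {L : List Event} {s : State} (h : EventTable L s) {e x lab : ℕ}
    (he : s.reg rEv = e) (hx : s.reg rX = x) (heL : e < L.length) (hxe : x ∉ (evAt L e).1)
    (hlab : lab = 0 ∨ lab = 1) :
    Reach (appendEvent lab) s 12 fun t => EventTable (L ++ [(insert x (evAt L e).1,
      if lab = 0 then (evAt L e).2 else insert x (evAt L e).2)]) t := by
  refine Reach.flat rfl (le_refl 12) ?_
  have hxe2 : x ∉ (evAt L e).2 := fun h' => hxe (h.subset e heL h')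
  have hpos := h.pos
  have hreg : (eval (appendEvent lab) s).reg rE = L.length + 1 := by
    simp [appendEvent, eval, h.length]
  have hsize : (eval (appendEvent lab) s).arr aSize =
      Function.update (s.arr aSize) L.length ((evAt L e).1.card + 1) := by
    simp [appendEvent, eval, h.length, he, h.size e heL]
  have htsize : (eval (appendEvent lab) s).arr aTsz =
      Function.update (s.arr aTsz) L.length ((evAt L e).2.card + lab) := by
    simp [appendEvent, eval, h.length, he, h.tsize e heL]
  have hpar : (eval (appendEvent lab) s).arr aPar = Function.update (s.arr aPar) L.length e := by
    simp [appendEvent, eval, h.length, he]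
  have helt : (eval (appendEvent lab) s).arr aElt = Function.update (s.arr aElt) L.length x := by
    simp [appendEvent, eval, h.length, hx]
  have hlb : (eval (appendEvent lab) s).arr aLab = Function.update (s.arr aLab) L.length lab := by
    simp [appendEvent, eval, h.length]
  have hcases : ∀ P : ℕ → Prop, (∀ i < L.length, P i) → P L.length →
      ∀ i < (L ++ [(insert x (evAt L e).1,
        if lab = 0 then (evAt L e).2 else insert x (evAt L e).2)]).length, P i := by
    intro P h1 h2 i hi
    rw [List.length_append, List.length_singleton] at hi
    rcases Nat.lt_succ_iff_lt_or_eq.1 hi with hi | rfl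
    exacts [h1 i hi, h2]
  constructor
  · rw [hreg, List.length_append, List.length_singleton]
  · simp
  · rw [evAt_append_left hpos, h.root]
  · refine hcases _ (fun i hi => ?_) ?_
    · rw [evAt_append_left hi]; exact h.subset i hi
    · rw [evAt_append_length]
      split_ifs
      · exact (h.subset e heL).trans (subset_insert _ _)
      · exact insert_subset_insert _ (h.subset e heL)
  · refine hcases _ (fun i hi => ?_) ?_
    · rw [evAt_append_left hi, hsize, Function.update_of_ne hi.ne, h.size i hi]
    · rw [evAt_append_length, hsize, Function.update_self, card_insert_of_notMem hxe]
  · refine hcases _ (fun i hi => ?_) ?_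
    · rw [evAt_append_left hi, htsize, Function.update_of_ne hi.ne, h.tsize i hi]
    · rw [evAt_append_length, htsize, Function.update_self]
      rcases hlab with rfl | rfl
      · simp
      · simp [card_insert_of_notMem hxe2]
  · refine hcases _ (fun i hi hi0 => ?_) fun _ => ?_
    · rw [hpar, Function.update_of_ne hi.ne]; exact h.parent_lt i hi hi0
    · rw [hpar, Function.update_self]; exact heL
  · refine hcases _ (fun i hi hi0 => ?_) fun _ => ?_
    · rw [hpar, helt, Function.update_of_ne hi.ne, Function.update_of_ne hi.ne,
        evAt_append_left ((h.parent_lt i hi hi0).trans hi)]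
      exact h.notMem i hi hi0
    · rw [hpar, helt, Function.update_self, Function.update_self, evAt_append_left heL]
      exact hxe
  · refine hcases _ (fun i hi hi0 => ?_) fun _ => ?_
    · rw [hpar, helt, hlb, Function.update_of_ne hi.ne, Function.update_of_ne hi.ne,
        Function.update_of_ne hi.ne, evAt_append_left ((h.parent_lt i hi hi0).trans hi),
        evAt_append_left hi]
      exact h.step i hi hi0
    · rw [hpar, helt, hlb, Function.update_self, Function.update_self, Function.update_self,
        evAt_append_left heL, evAt_append_length]

theorem reach_listEvents {n p : ℕ} {s : State} (hn : s.reg rN = n) (hp : s.reg rP = p)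
    (h0 : s.arr aSize 0 = 0) (h0' : s.arr aTsz 0 = 0) :
    Reach listEvents s (n * ((eventList p n).length * 31 + 9) + 4) fun t =>
      EventTable (eventList p n) t := by
  rw [show n * ((eventList p n).length * 31 + 9) + 4 = 1 +
    (n * ((1 + (1 + ((eventList p n).length * ((1 + (1 + (12 + 12 + 1))) + 4) + 3))) + 4) + 3)
    by ring]
  refine .seq (.flat rfl le_rfl ?_)
  refine (Reach.forTo (fun k t => EventTable (eventList p k) t) (by simp [eval, hn])
    (by decide) ?_ ?_)
  · constructor <;> simp [eval, eventList, evAt, h0, h0']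
  · intro k hk t ht htk hI
    have htP : t.reg rP = p := by rw [ht.1 _ (by decide)]; simp [eval, hp]
    refine .seq (.flat rfl le_rfl (.seq (.flat rfl le_rfl ?_)))
    set L := eventList p k with hL
    set u := eval (.add rCur rE 0) (eval (.const 0 0) t)
    have huC : u.reg rCur = L.length := by simp [u, eval, hI.length]
    have huX : u.reg rX = k := by simp [u, eval, htk]
    have huP : u.reg rP = p := by simp [u, eval, htP]
    refine (Reach.forTo (T := 1 + (1 + (12 + 12 + 1))) (fun j t => EventTable (L ++ (L.take j).flatMap (extensions p k)) t) huC
      (by decide) ?_ ?_).mono ?_ ?_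
    · rw [List.take_zero, List.flatMap_nil, List.append_nil]
      exact hI.congr (by simp [u, eval]) (by simp [u, eval])
    · intro j hj w hw hwj hJ
      have hwX : w.reg rX = k := by rw [hw.1 _ (by decide), huX]
      have hwP : w.reg rP = p := by rw [hw.1 _ (by decide), huP]
      set L' := L ++ (L.take j).flatMap (extensions p k) with hL'
      have hjL' : j < L'.length := by rw [hL', List.length_append]; omega
      have hev : evAt L' j = evAt L j := evAt_append_left hj
      have hkj : k ∉ (evAt L j).1 := fun h' => by
        simpa using (mem_eventList (evAt_mem hj)).2.1 h'
      have hnext : L ++ (L.take (j + 1)).flatMap (extensions p k) =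
          L' ++ extensions p k (evAt L j) := by
        have : evAt L j = L[j] := by simp [evAt, List.getD, List.getElem?_eq_getElem hj]
        rw [List.take_succ_eq_append_getElem hj, List.flatMap_append, hL', List.append_assoc,
          List.flatMap_singleton, this]
      rw [hnext]
      refine .seq (.flat rfl le_rfl (.seq (.flat rfl le_rfl ?_)))
      set z := eval (.sub rU rP rU) (eval (.load rU aSize rEv) w)
      have hz : EventTable L' z := hJ.congr (by simp [z, eval]) (by simp [z, eval])
      have hzU : z.reg rU = p - (evAt L j).1.card := by
        simp [z, eval, hwP, hwj, hJ.size j hjL', hev]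
      have hzj : z.reg rEv = j := by simp [z, eval, hwj]
      have hzX : z.reg rX = k := by simp [z, eval, hwX]
      refine .branch (fun hpos => ?_) fun hzero => ?_
      · rw [extensions, if_pos (by omega)]
        refine (reach_appendEvent hz hzj hzX hjL' (by rwa [hev]) (.inl rfl)).then ?_
        intro a ha hA
        have hlt : j < (L' ++ [(insert k (evAt L' j).1,
          if 0 = 0 then (evAt L' j).2 else insert k (evAt L' j).2)]).length := by
            rw [List.length_append]; omega
        refine (reach_appendEvent hA (e := j) (x := k) (by rw [ha.1 _ (by decide), hzj])
          (by rw [ha.1 _ (by decide), hzX]) hlt (by rwa [evAt_append_left hjL', hev])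
          (.inr rfl)).mono le_rfl ?_
        intro b hb hB
        rw [evAt_append_left hjL', hev, List.append_assoc] at hB
        exact hB.congr (by simp) (by simp)
      · rw [extensions, if_neg (by omega), List.append_nil]
        refine .flat rfl (by decide) ?_
        exact hz.congr (by simp [eval]) (by simp [eval])
    · have : L.length ≤ (eventList p n).length := length_eventList_mono p hk.le
      gcongr
    · intro w _ hW
      rw [List.take_length] at hW
      exact hW.congr (by simp) (by simp)

theorem reach_markRelevant {L : List Event} {p : ℕ} {τ : ℕ → ℕ} {s : State}
    (h : EventTable L s) (hp : ∀ e < L.length, (evAt L e).1.card ≤ p)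
    (hτ : ∀ j ≤ p, s.arr aT j = τ j) :
    Reach markRelevant s (L.length * 13 + 3) fun t => ∀ e < L.length,
      t.arr aLive e = if (evAt L e).2.card = τ (evAt L e).1.card then 1 else 0 := by
  refine Reach.forTo (T := 9) (fun k t => ∀ e < k,
      t.arr aLive e = if (evAt L e).2.card = τ (evAt L e).1.card then 1 else 0) h.length
      (by decide) (by simp) ?_
  intro k hk t ht htk hI
  have h' := h.agree ht (by decide)
  have hT : t.arr aT = s.arr aT := ht.2 _ (by decide)
  refine .flat rfl (by decide) ?_
  simp [eval, htk, h'.size k hk, h'.tsize k hk, hT, hτ _ (hp k hk)]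
  intro e he
  by_cases hek : e = k
  · subst hek
    simp only [Function.update_self]
    split_ifs <;> omega
  · rw [Function.update_of_ne hek]
    exact hI e (by omega)

/-- The total weight of the events that are alive and not hit by the row `R`; the weight of
`(S, T)` is `w |S|`. -/
def weight (L : List Event) (A R w : ℕ → ℕ) : ℕ :=
  ∑ e ∈ range L.length, if A e ≠ 0 ∧ ¬ Hit R (evAt L e) then w (evAt L e).1.card else 0

theorem reach_evalRow {L : List Event} {s : State} (h : EventTable L s)
    (hS : s.arr aS 0 = 0) (hC : s.arr aC 0 = 0) :
    Reach evalRow s (L.length * 31 + 4) fun t =>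
      t.reg rSum = weight L (s.arr aLive) (s.arr aRow) (fun j => s.arr aW (s.reg rBase + j)) ∧
      (∀ e < L.length, t.arr aNew e =
        if s.arr aLive e ≠ 0 ∧ ¬ Hit (s.arr aRow) (evAt L e) then 1 else 0) ∧
      t.arr aS 0 = 0 ∧ t.arr aC 0 = 0 := by
  set R := s.arr aRow with hR
  set A := s.arr aLive with hA
  rw [show L.length * 31 + 4 = 1 + (L.length * (12 + 15 + 4) + 3) by ring]
  refine .seq (.flat rfl le_rfl ?_)
  refine (Reach.forTo (fun k t => t.reg rSum = ∑ e ∈ range k,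
        (if A e ≠ 0 ∧ ¬ Hit R (evAt L e) then s.arr aW (s.reg rBase + (evAt L e).1.card) else 0) ∧
      (∀ e < k, t.arr aNew e = if A e ≠ 0 ∧ ¬ Hit R (evAt L e) then 1 else 0) ∧
      (t.arr aS 0 = 0 ∧ t.arr aC 0 = 0) ∧
      ∀ e < k, t.arr aS e = ∑ x ∈ (evAt L e).1, R x ∧ t.arr aC e = ∑ x ∈ (evAt L e).2, R x)
    (by simp [eval, h.length]) (by decide) (by simp [eval, hS, hC]) ?_).mono le_rfl
    fun t _ ht => ⟨ht.1, ht.2.1, ht.2.2.1⟩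
  rintro k hk t ht htk ⟨hI1, hI2, hI3, hI4⟩
  have hs0 : EventTable L (eval (.const rSum 0) s) := h.congr (by simp [eval]) (by simp [eval])
  have h' := hs0.agree ht (by decide)
  have htR : t.arr aRow = R := by rw [ht.2 _ (by decide)]; simp [eval, hR]
  have htA : t.arr aLive = A := by rw [ht.2 _ (by decide)]; simp [eval, hA]
  have htW : t.arr aW = s.arr aW := by rw [ht.2 _ (by decide)]; simp [eval]
  have htB : t.reg rBase = s.reg rBase := by rw [ht.1 _ (by decide)]; simp [eval]
  refine Reach.then (P := fun u => ∀ e < k + 1,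
      u.arr aS e = ∑ x ∈ (evAt L e).1, R x ∧ u.arr aC e = ∑ x ∈ (evAt L e).2, R x) ?_ ?_
  · refine .branch (T := 11) (fun hk0 => .flat rfl (by decide) ?_)
      fun hk0 => .flat rfl (by decide) ?_
    · rw [htk] at hk0
      have hpar := h'.parent_lt k hk hk0
      have hnm := h'.notMem k hk hk0
      have hnm2 : t.arr aElt k ∉ (evAt L (t.arr aPar k)).2 := fun hh =>
        hnm (h'.subset _ (hpar.trans hk) hh)
      have hstep := h'.step k hk hk0
      obtain ⟨p1, p2⟩ := hI4 _ hpar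
      intro e he
      by_cases hek : e = k
      · subst hek
        rw [hstep]
        by_cases hl : t.arr aLab e = 0
        · simp [eval, htk, hl, htR, p1, p2, sum_insert hnm, add_comm]
        · simp [eval, htk, hl, htR, p1, p2, sum_insert hnm, sum_insert hnm2, add_comm]
      · obtain ⟨q1, q2⟩ := hI4 e (by omega)
        by_cases hl : t.arr aLab k = 0
        · simp [eval, htk, hl, hek, q1, q2]
        · simp [eval, htk, hl, hek, q1, q2]
    · rw [htk] at hk0
      subst hk0
      intro e he
      obtain rfl : e = 0 := by omega
      simp [eval, hI3, h.root]
  · intro u hu hP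
    obtain ⟨hPS, hPC⟩ := hP k (by omega)
    have hle : ∑ x ∈ (evAt L k).2, R x ≤ ∑ x ∈ (evAt L k).1, R x :=
      sum_le_sum_of_subset (h.subset k hk)
    have huk : u.reg rEv = k := by rw [hu.1 _ (by decide), htk]
    have huA : u.arr aLive = A := by rw [hu.2 _ (by decide), htA]
    have huW : u.arr aW = s.arr aW := by rw [hu.2 _ (by decide), htW]
    have huB : u.reg rBase = s.reg rBase := by rw [hu.1 _ (by decide), htB]
    have huSz : u.arr aSize k = (evAt L k).1.card := by rw [hu.2 _ (by decide), h'.size k hk]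
    have huN : u.arr aNew = t.arr aNew := hu.2 _ (by decide)
    have huSum : u.reg rSum = t.reg rSum := hu.1 _ (by decide)
    have h00 : u.arr aS 0 = 0 ∧ u.arr aC 0 = 0 := by
      have := hP 0 (by omega)
      rwa [h.root] at this
    have hnew : ∀ a, (∀ e < k + 1, Function.update (t.arr aNew) k a e =
        if A e ≠ 0 ∧ ¬ Hit R (evAt L e) then 1 else 0) ↔
          a = if A k ≠ 0 ∧ ¬ Hit R (evAt L k) then 1 else 0 := by
      refine fun a => ⟨fun hh => ?_, fun hh e he => ?_⟩
      · simpa using hh k (by omega)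
      · by_cases hek : e = k
        · subst hek; simpa using hh
        · rw [Function.update_of_ne hek]; exact hI2 e (by omega)
    refine .flat rfl (by decide) ?_
    rw [sum_range_succ, ← hI1]
    by_cases hAk : A k = 0
    · simp only [eval, huk, huA, hAk, State.setReg_reg, State.setReg_arr, State.setArr_arr,
        State.setArr_reg, if_true, Nat.reduceEqDiff, if_false, huN, huSum, OfNat.ofNat_ne_zero, OfNat.zero_ne_ofNat]
      rw [hnew]
      simpa [hAk, h00] using hP
    · by_cases hh : Hit R (evAt L k)
      · obtain ⟨h1, h2⟩ := hh
        simp only [eval, huk, huA, hAk, State.setReg_reg, State.setReg_arr, State.setArr_arr,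
          State.setArr_reg, if_true, Nat.reduceEqDiff, if_false, huN, huSum, hPS, hPC, h1, h2, OfNat.ofNat_ne_zero, OfNat.zero_ne_ofNat]
        rw [hnew]
        simpa [Hit, h1, h2, h00] using hP
      · have hq : ¬ (∑ x ∈ (evAt L k).1, R x - 1 + (1 - ∑ x ∈ (evAt L k).2, R x) = 0) := by
          intro h0; exact hh ⟨by omega, by omega⟩
        simp only [eval, huk, huA, hAk, State.setReg_reg, State.setReg_arr, State.setArr_arr,
          State.setArr_reg, if_true, Nat.reduceEqDiff, if_false, huN, huSum, hPS, hPC, hq, huSz,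
          huB, huW, OfNat.ofNat_ne_zero, OfNat.zero_ne_ofNat]
        rw [hnew]
        simpa [hAk, hh, h00, add_comm] using hP

end RAM

/-! ### The number of rows, and the rows of the pool -/

namespace RAM
open Prog

theorem weight_congr {L : List Event} {n p : ℕ} (hL : ∀ e < L.length, (evAt L e).2 ⊆ (evAt L e).1 ∧
    (evAt L e).1 ⊆ range n ∧ (evAt L e).1.card ≤ p) {A A' R R' w w' : ℕ → ℕ}
    (hA : ∀ e < L.length, A e = A' e) (hR : ∀ x < n, R x = R' x) (hw : ∀ j ≤ p, w j = w' j) :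
    weight L A R w = weight L A' R' w' := by
  refine sum_congr rfl fun e he => ?_
  rw [mem_range] at he
  obtain ⟨h1, h2, h3⟩ := hL e he
  simp only [hA e he, Hit.congr h2 h1 hR, hw _ h3]

theorem not_hit_zero (e : Event) : ¬ Hit (fun _ => 0) e := fun h => by simpa using h.1

/-- The memory holds the powers `X_j ^ i` for `i ≤ m`, and `rBase` points to the last of them. -/
structure PowerTable (p Y : ℕ) (X : ℕ → ℕ) (m : ℕ) (s : State) : Prop where
  base : s.reg rBase = m * (p + 1)
  pow : s.reg rPow = Y ^ m
  size : s.reg rM = m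
  table : ∀ i ≤ m, ∀ j ≤ p, s.arr aW (i * (p + 1) + j) = X j ^ i

theorem PowerTable.agree {p Y m : ℕ} {X : ℕ → ℕ} {c : Prog} {s t : State}
    (h : PowerTable p Y X m s) (ha : Agree c s t)
    (hc : (rBase ∉ c.regs ∧ rPow ∉ c.regs ∧ rM ∉ c.regs) ∧ aW ∉ c.arrs) : PowerTable p Y X m t := by
  obtain ⟨⟨c1, c2, c3⟩, c4⟩ := hc
  exact ⟨by rw [ha.1 _ c1, h.base], by rw [ha.1 _ c2, h.pow], by rw [ha.1 _ c3, h.size],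
    by rw [ha.2 _ c4]; exact h.table⟩

theorem reach_nextPowers {p Y m : ℕ} {X : ℕ → ℕ} {s : State} (h : PowerTable p Y X m s)
    (hp : s.reg rP1 = p + 1) (hY : s.reg rY = Y) (hX : ∀ j ≤ p, s.arr aX j = X j)
    (hXY : ∀ j ≤ p, X j ≤ Y) :
    Reach nextPowers s ((p + 1) * (Y * 5 + 13) + Y * 5 + 12) (PowerTable p Y X (m + 1)) := by
  rw [show (p + 1) * (Y * 5 + 13) + Y * 5 + 12 = ((p + 1) * ((1 + (1 + (1 + ((Y * 5 + 4) + 2)))) +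
    4) + 3) + (1 + ((Y * 5 + 4) + 4)) by ring]
  refine (Reach.forTo (fun k t => (∀ q < (m + 1) * (p + 1), t.arr aW q = s.arr aW q) ∧
    ∀ j < k, t.arr aW ((m + 1) * (p + 1) + j) = X j ^ (m + 1)) hp (by decide) (by simp) ?_).then ?_
  · rintro k hk t ht htk ⟨hI1, hI2⟩
    have htB : t.reg rBase = m * (p + 1) := by rw [ht.1 _ (by decide), h.base]
    have htX : t.arr aX = s.arr aX := ht.2 _ (by decide)
    have htP : t.reg rP1 = p + 1 := by rw [ht.1 _ (by decide), hp]
    refine .seq (.flat rfl le_rfl (.seq (.flat rfl le_rfl (.seq (.flat rfl le_rfl ?_)))))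
    have hlt : m * (p + 1) + k < (m + 1) * (p + 1) := by rw [Nat.succ_mul]; omega
    refine ((reach_mul (a := X k) (b := X k ^ m) (by simp [eval, htk, htX, hX k (by omega)])
      (by simp [eval, htk, htB, hI1 _ hlt, h.table m le_rfl k (by omega)]) (by decide)).mono
      (show _ ≤ Y * 5 + 4 by have := hXY k (by omega); omega) fun _ _ h => h).then ?_
    intro u hu huZ
    have huU : u.reg rU = m * (p + 1) + k := by
      rw [hu.1 _ (by decide)]; simp [eval, htk, htB]
    have huP : u.reg rP1 = p + 1 := by
      rw [hu.1 _ (by decide)]; simp [eval, htP]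
    have huW : u.arr aW = t.arr aW := by
      rw [hu.2 _ (by decide)]; simp [eval]
    have hidx : m * (p + 1) + k + (p + 1) = (m + 1) * (p + 1) + k := by ring
    refine .flat rfl (by decide) ?_
    simp only [eval, State.setReg_reg, State.setReg_arr, State.setArr_arr, huU, huP, huZ, huW,
      if_true, Nat.reduceEqDiff, if_false, hidx]
    refine ⟨fun q hq => ?_, fun j hj => ?_⟩
    · rw [Function.update_of_ne (by omega)]; exact hI1 q hq
    · by_cases hjk : j = k
      · subst hjk; rw [Function.update_self]; ring
      · rw [Function.update_of_ne (by omega)]; exact hI2 j (by omega)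
  · rintro t ht ⟨hI1, hI2⟩
    refine .seq (.flat rfl le_rfl ?_)
    refine (reach_mul (a := Y) (b := Y ^ m) ?_ ?_ (by decide)).then ?_
    · simp only [eval, State.setReg_reg, Nat.reduceEqDiff, if_false]
      rw [ht.1 _ (by decide), hY]
    · simp only [eval, State.setReg_reg, Nat.reduceEqDiff, if_false]
      rw [ht.1 _ (by decide), h.pow]
    intro u hu huU
    have huB : u.reg rBase = (m + 1) * (p + 1) := by
      rw [hu.1 _ (by decide)]
      simp only [eval, State.setReg_reg, if_true]
      rw [ht.1 _ (by decide), ht.1 _ (by decide), h.base, hp]; ring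
    have huM : u.reg rM = m := by
      rw [hu.1 _ (by decide)]
      simp only [eval, State.setReg_reg, Nat.reduceEqDiff, if_false]
      rw [ht.1 _ (by decide), h.size]
    have huW : u.arr aW = t.arr aW := by
      rw [hu.2 _ (by decide)]; simp [eval]
    refine .flat rfl (by decide) ⟨?_, ?_, ?_, ?_⟩
    · simp [eval, huB]
    · simp [eval, huU]; ring
    · simp [eval, huM]
    · intro i hi j hj
      simp only [eval, State.setReg_arr, huW]
      rcases Nat.lt_or_eq_of_le hi with hi | rfl
      · have hlt : i * (p + 1) + j < (m + 1) * (p + 1) := by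
          calc i * (p + 1) + j < (i + 1) * (p + 1) := by rw [Nat.succ_mul]; omega
            _ ≤ _ := Nat.mul_le_mul_right _ (by omega)
        rw [hI1 _ hlt, h.table i (by omega) j hj]
      · exact hI2 j (by omega)

theorem reach_testSize {L : List Event} {n p Y m : ℕ} {X : ℕ → ℕ} {s : State}
    (hT : EventTable L s) (hL : ∀ e < L.length, (evAt L e).2 ⊆ (evAt L e).1 ∧
      (evAt L e).1 ⊆ range n ∧ (evAt L e).1.card ≤ p)
    (hS : s.arr aS 0 = 0) (hC : s.arr aC 0 = 0) (h : PowerTable p Y X m s)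
    (hR : ∀ x < n, s.arr aRow x = 0) :
    Reach testSize s (L.length * 31 + 7) fun t => PowerTable p Y X m t ∧
      t.reg rCond = weight L (s.arr aLive) (fun _ => 0) (fun j => X j ^ m) + 1 - Y ^ m ∧
      t.arr aS 0 = 0 ∧ t.arr aC 0 = 0 := by
  refine (reach_evalRow hT hS hC).then (T₂ := 3) ?_
  rintro t ht ⟨h1, -, h3, h4⟩
  have h' := h.agree ht (by decide)
  have hw : t.reg rSum = weight L (s.arr aLive) (fun _ => 0) (fun j => X j ^ m) := by
    rw [h1]
    refine weight_congr hL (fun _ _ => rfl) hR fun j hj => ?_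
    rw [h.base, h.table m le_rfl j hj]
  refine .flat rfl (by decide) ⟨⟨?_, ?_, ?_, ?_⟩, ?_, ?_, ?_⟩
  · simp [eval, h'.base]
  · simp [eval, h'.pow]
  · simp [eval, h'.size]
  · simpa [eval] using h'.table
  · simp [eval, hw, h'.pow]
  · simp [eval, h3]
  · simp [eval, h4]

theorem reach_findSize {L : List Event} {n p Y m : ℕ} {X : ℕ → ℕ} {s : State}
    (hT : EventTable L s) (hL : ∀ e < L.length, (evAt L e).2 ⊆ (evAt L e).1 ∧
      (evAt L e).1 ⊆ range n ∧ (evAt L e).1.card ≤ p)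
    (hS : s.arr aS 0 = 0) (hC : s.arr aC 0 = 0) (hB : s.reg rBase = 0) (hM : s.reg rM = 0)
    (hW : ∀ j ≤ p, s.arr aW j = 1) (hR : ∀ x < n, s.arr aRow x = 0)
    (hp : s.reg rP1 = p + 1) (hY : s.reg rY = Y) (hX : ∀ j ≤ p, s.arr aX j = X j)
    (hXY : ∀ j ≤ p, X j ≤ Y)
    (hm : weight L (s.arr aLive) (fun _ => 0) (fun j => X j ^ m) < Y ^ m)
    (hmin : ∀ k < m, Y ^ k ≤ weight L (s.arr aLive) (fun _ => 0) (fun j => X j ^ k)) :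
    Reach findSize s (m * ((p + 1) * (Y * 5 + 13) + Y * 5 + L.length * 31 + 20) +
        L.length * 31 + 9) fun t =>
      PowerTable p Y X m t ∧ t.arr aS 0 = 0 ∧ t.arr aC 0 = 0 := by
  rw [show m * ((p + 1) * (Y * 5 + 13) + Y * 5 + L.length * 31 + 20) + L.length * 31 + 9 =
    1 + ((L.length * 31 + 7) + (m * ((((p + 1) * (Y * 5 + 13) + Y * 5 + 12) +
      (L.length * 31 + 7)) + 1) + 1)) by ring]
  refine .seq (.flat rfl le_rfl ?_)
  have hP : PowerTable p Y X 0 (eval (.const rPow 1) s) := by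
    refine ⟨by simp [eval, hB], by simp [eval], by simp [eval, hM], ?_⟩
    intro i hi j hj
    obtain rfl : i = 0 := by omega
    simp [eval, hW j hj]
  have hT' : EventTable L (eval (.const rPow 1) s) := hT.congr (by simp [eval]) (by simp [eval])
  refine (reach_testSize hT' hL (by simp [eval, hS]) (by simp [eval, hC]) hP
    (by simpa [eval] using hR)).then ?_
  intro t ht hpost
  have htT := hT'.agree ht (by decide)
  have htA : t.arr aLive = s.arr aLive := by rw [ht.2 _ (by decide)]; simp [eval]
  have htX : t.arr aX = s.arr aX := by rw [ht.2 _ (by decide)]; simp [eval]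
  have htR : t.arr aRow = s.arr aRow := by rw [ht.2 _ (by decide)]; simp [eval]
  have htP : t.reg rP1 = p + 1 := by rw [ht.1 _ (by decide)]; simp [eval, hp]
  have htY : t.reg rY = Y := by rw [ht.1 _ (by decide)]; simp [eval, hY]
  refine (Reach.loop (Inv := fun k t => PowerTable p Y X k t ∧
      t.reg rCond = weight L (s.arr aLive) (fun _ => 0) (fun j => X j ^ k) + 1 - Y ^ k ∧
      t.arr aS 0 = 0 ∧ t.arr aC 0 = 0) hpost ?_ ?_).mono le_rfl
    fun u _ hu => ⟨hu.1, hu.2.2⟩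
  · rintro k hk u hu ⟨h1, h2, h3, h4⟩
    refine ⟨by have := hmin k hk; omega, ?_⟩
    refine (reach_nextPowers h1 (by rw [hu.1 _ (by decide), htP]) (by rw [hu.1 _ (by decide), htY])
      (by rw [hu.2 _ (by decide), htX]; exact hX) hXY).then ?_
    intro w hw hwP
    have hwu := hu.trans (hw.mono (d := nextPowers ;; testSize) (by decide) (by decide))
    refine (reach_testSize (htT.agree hwu (by decide)) hL (by rw [hw.2 _ (by decide), h3])
      (by rw [hw.2 _ (by decide), h4]) hwP
      (by rw [hwu.2 _ (by decide), htR]; exact hR)).mono le_rfl ?_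
    intro z _ hz
    rwa [hwu.2 aLive (by decide), htA] at hz
  · rintro u - ⟨-, h2, -⟩
    omega

theorem reach_copyBest {n : ℕ} {s : State} (hn : s.reg rN = n) :
    Reach copyBest s (n * 6 + 5) fun t =>
      t.reg rBest = s.reg rSum ∧ ∀ x < n, t.arr aBest x = s.arr aRow x := by
  rw [show n * 6 + 5 = 1 + (1 + (n * (2 + 4) + 3)) by ring]
  refine .seq (.flat rfl le_rfl (.seq (.flat rfl le_rfl ?_)))
  refine Reach.forTo (fun k t => t.reg rBest = s.reg rSum ∧
    ∀ x < k, t.arr aBest x = s.arr aRow x) (by simp [eval, hn]) (by decide) (by simp [eval]) ?_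
  rintro k hk t ht htk ⟨h1, h2⟩
  have htR : t.arr aRow = s.arr aRow := by rw [ht.2 _ (by decide)]; simp [eval]
  refine .flat rfl (by decide) ?_
  simp [eval, htk, htR, h1]
  intro x hx
  by_cases hxk : x = k
  · simp [hxk]
  · rw [Function.update_of_ne hxk]; exact h2 x (by omega)

theorem reach_hashRow {n Q B a b : ℕ} {s : State} (hn : s.reg rN = n) (hQ : s.reg rQ = Q)
    (hB : s.reg rB = B) (ha : s.reg rA = a) (hb : s.reg rS = b) :
    Reach hashRow s (n * 14 + 5) fun t => ∀ x < n, t.arr aRow x = poolRow Q B a b x := by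
  rw [show n * 14 + 5 = 1 + (1 + (n * (10 + 4) + 3)) by ring]
  refine .seq (.flat rfl le_rfl (.seq (.flat rfl le_rfl ?_)))
  refine (Reach.forTo (fun k t => t.reg rH = hashVal Q a b k ∧
    ∀ x < k, t.arr aRow x = poolRow Q B a b x) (by simp [eval, hn]) (by decide)
      (by simp [eval, hb, hashVal]) ?_).mono le_rfl fun _ _ h => h.2
  rintro k hk t ht htk ⟨h1, h2⟩
  have htQ : t.reg rQ = Q := by rw [ht.1 _ (by decide)]; simp [eval, hQ]
  have htB : t.reg rB = B := by rw [ht.1 _ (by decide)]; simp [eval, hB]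
  have hta : t.reg rA = a := by rw [ht.1 _ (by decide)]; simp [eval, ha]
  have hupd : ∀ r, r = poolRow Q B a b k → ∀ x < k + 1,
      Function.update (t.arr aRow) k r x = poolRow Q B a b x := by
    intro r hr x hx
    by_cases hxk : x = k
    · rw [hxk, Function.update_self, hr]
    · rw [Function.update_of_ne hxk]; exact h2 x (by omega)
  refine .seq (T₁ := 1) (T₂ := 9) (.flat rfl le_rfl (.seq (T₁ := 2) (.flat rfl (by decide)
    (.seq (T₁ := 1) (T₂ := 6) (.flat rfl (by decide) ?_)))))
  set u := eval (.store aRow rX rU) _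
  have hu : u.reg rH = hashVal Q a b k ∧ u.reg rA = a ∧ u.reg rQ = Q ∧
      u.arr aRow = Function.update (t.arr aRow) k (poolRow Q B a b k) := by
    by_cases h : hashVal Q a b k < B
    · simp [u, eval, h1, htB, htQ, hta, htk, poolRow, h, show ¬ B - hashVal Q a b k = 0 by omega]
    · simp [u, eval, h1, htB, htQ, hta, htk, poolRow, h, show B - hashVal Q a b k = 0 by omega]
  obtain ⟨u1, u2, u3, u4⟩ := hu
  refine .flat rfl (by decide) ?_
  by_cases h : Q ≤ hashVal Q a b k + a
  · simpa [eval, u1, u2, u3, u4, hashVal, h,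
      show ¬ hashVal Q a b k + a + 1 - Q = 0 by omega] using hupd _ rfl
  · simpa [eval, u1, u2, u3, u4, hashVal, h,
      show hashVal Q a b k + a + 1 - Q = 0 by omega] using hupd _ rfl

end RAM

/-! ### The greedy choice -/

namespace RAM
open Prog

/-- During the search for the best row: `A` marks the events that are alive, `w` are the weights,
`aBest` holds the best row so far, of weight `rBest`, and no row in `C` is better. -/
structure BestInv (n p : ℕ) (L : List Event) (A w : ℕ → ℕ) (C : Set (ℕ → ℕ)) (s : State) : Prop where
  table : EventTable L s
  cols : s.reg rN = n
  bound : s.reg rL = 2 * n + 1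
  alive : s.arr aLive = A
  weights : ∀ j ≤ p, s.arr aW (s.reg rBase + j) = w j
  zeroS : s.arr aS 0 = 0
  zeroC : s.arr aC 0 = 0
  row_le : ∀ x < n, s.arr aRow x ≤ 1
  best_le : ∀ x < n, s.arr aBest x ≤ 1
  best : s.reg rBest = weight L A (s.arr aBest) w
  min : ∀ R ∈ C, s.reg rBest ≤ weight L A R w

section

variable {n p : ℕ} {L : List Event} {A w : ℕ → ℕ}

theorem BestInv.setReg {C : Set (ℕ → ℕ)} {s : State} (h : BestInv n p L A w C s) {x a : ℕ}
    (hx : x ≠ rE ∧ x ≠ rN ∧ x ≠ rL ∧ x ≠ rBase ∧ x ≠ rBest) :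
    BestInv n p L A w C (s.setReg x a) := by
  obtain ⟨h1, h2, h3, h4, h5⟩ := hx
  have e1 := h1.symm
  have e2 := h2.symm
  have e3 := h3.symm
  have e4 := h4.symm
  have e5 := h5.symm
  exact ⟨h.table.congr (by simp [e1]) (by simp), by simp [e2, h.cols],
    by simp [e3, h.bound], h.alive, by simpa [e4] using h.weights, h.zeroS, h.zeroC, h.row_le,
    h.best_le, by simp [e5, h.best], by simpa [e5] using h.min⟩

theorem BestInv.mono {C D : Set (ℕ → ℕ)} {s : State} (h : BestInv n p L A w C s) (hD : D ⊆ C) :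
    BestInv n p L A w D s :=
  { h with min := fun R hR => h.min R (hD hR) }

theorem reach_tryRow (hL : ∀ e < L.length, (evAt L e).2 ⊆ (evAt L e).1 ∧
      (evAt L e).1 ⊆ range n ∧ (evAt L e).1.card ≤ p)
    {C : Set (ℕ → ℕ)} {s : State} (h : BestInv n p L A w C s) {Q B a b : ℕ}
    (hQ : s.reg rQ = Q) (hB : s.reg rB = B) (ha : s.reg rA = a) (hb : s.reg rS = b) :
    Reach tryRow s (n * 20 + L.length * 31 + 16)
      (BestInv n p L A w (C ∪ {poolRow Q B a b})) := by
  rw [show n * 20 + L.length * 31 + 16 = (n * 14 + 5) + ((L.length * 31 + 4) + (1 +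
    ((n * 6 + 5) + 1))) by ring]
  refine (reach_hashRow h.cols hQ hB ha hb).then ?_
  intro t ht htR
  have hT := h.table.agree ht (by decide)
  have htA : t.arr aLive = A := by rw [ht.2 _ (by decide), h.alive]
  have htw : ∀ j ≤ p, t.arr aW (t.reg rBase + j) = w j := by
    rw [ht.2 aW (by decide), ht.1 rBase (by decide)]; exact h.weights
  refine (reach_evalRow hT (by rw [ht.2 _ (by decide), h.zeroS])
    (by rw [ht.2 _ (by decide), h.zeroC])).then ?_
  rintro u hu ⟨huSum, -, huS, huC⟩
  rw [htA, weight_congr hL (fun _ _ => rfl) htR htw] at huSum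
  have htu : Agree (hashRow ;; evalRow) s u :=
    (ht.mono (by decide) (by decide)).trans (hu.mono (by decide) (by decide))
  have huR : u.arr aRow = t.arr aRow := hu.2 _ (by decide)
  have hrow : ∀ x < n, u.arr aRow x = poolRow Q B a b x := by rw [huR]; exact htR
  have huBest : u.reg rBest = s.reg rBest := htu.1 _ (by decide)
  have huI : BestInv n p L A w C u :=
    { table := hT.agree hu (by decide)
      cols := by rw [htu.1 _ (by decide), h.cols]
      bound := by rw [htu.1 _ (by decide), h.bound]
      alive := by rw [htu.2 _ (by decide), h.alive]
      weights := by rw [htu.2 aW (by decide), htu.1 rBase (by decide)]; exact h.weights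
      zeroS := huS
      zeroC := huC
      row_le := fun x hx => by rw [hrow x hx]; exact poolRow_le_one ..
      best_le := by rw [htu.2 aBest (by decide)]; exact h.best_le
      best := by rw [huBest, htu.2 aBest (by decide)]; exact h.best
      min := by rw [huBest]; exact h.min }
  refine .seq (.flat rfl le_rfl ?_)
  have hz : BestInv n p L A w C (u.setReg rU (u.reg rBest - u.reg rSum)) := huI.setReg (by decide)
  change Reach _ (u.setReg rU (u.reg rBest - u.reg rSum)) _ _
  refine .branch (fun hpos => ?_) fun hzero => ?_
  · have hlt : weight L A (poolRow Q B a b) w < u.reg rBest := by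
      simp only [State.setReg_reg, if_true] at hpos; omega
    refine (reach_copyBest hz.cols).mono le_rfl ?_
    rintro z hag ⟨h1, h2⟩
    simp only [State.setReg_reg, Nat.reduceEqDiff, if_false, State.setReg_arr] at h1 h2
    have hzb : ∀ x < n, z.arr aBest x = poolRow Q B a b x := fun x hx => by
      rw [h2 x hx, hrow x hx]
    exact
    { table := hz.table.agree hag (by decide)
      cols := by rw [hag.1 _ (by decide), hz.cols]
      bound := by rw [hag.1 _ (by decide), hz.bound]
      alive := by rw [hag.2 _ (by decide), hz.alive]
      weights := by rw [hag.2 aW (by decide), hag.1 rBase (by decide)]; exact hz.weights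
      zeroS := by rw [hag.2 _ (by decide), hz.zeroS]
      zeroC := by rw [hag.2 _ (by decide), hz.zeroC]
      row_le := by rw [hag.2 _ (by decide)]; exact hz.row_le
      best_le := fun x hx => by rw [hzb x hx]; exact poolRow_le_one ..
      best := by
        rw [h1, huSum]
        exact (weight_congr hL (fun _ _ => rfl) hzb fun _ _ => rfl).symm
      min := by
        rw [h1, huSum]
        rintro R (hR | rfl)
        · exact hlt.le.trans (huI.min R hR)
        · exact le_rfl }
  · refine .flat rfl (by simp [cost]) ?_
    simp only [State.setReg_reg, if_true] at hzero
    refine { hz with min := ?_ }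
    rintro R (hR | rfl)
    · exact hz.min R hR
    · simp only [eval, State.setReg_reg, Nat.reduceEqDiff, if_false]; omega

/-- One of the nested loops of the search for the best row. -/
theorem reach_poolLoop {i T : ℕ} {c : Prog} {C : Set (ℕ → ℕ)} {D : ℕ → Set (ℕ → ℕ)} {s : State}
    (hi : ((i ≠ 0 ∧ rL ≠ 0 ∧ i ≠ rL ∧ i ∉ c.regs) ∧ rL ∉ c.regs) ∧
      i ≠ rE ∧ i ≠ rN ∧ i ≠ rL ∧ i ≠ rBase ∧ i ≠ rBest)
    (h : BestInv n p L A w C s)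
    (hstep : ∀ C : Set (ℕ → ℕ), ∀ k < 2 * n + 1, ∀ t, Agree (forTo i rL c) s t → t.reg i = k →
      BestInv n p L A w C t → Reach c t T (BestInv n p L A w (C ∪ D k))) :
    Reach (forTo i rL c) s ((2 * n + 1) * (T + 4) + 3)
      (BestInv n p L A w (C ∪ {R | ∃ k < 2 * n + 1, R ∈ D k})) := by
  refine Reach.forTo (fun k => BestInv n p L A w (C ∪ {R | ∃ l < k, R ∈ D l})) h.bound hi.1 ?_ ?_
  · simpa using (h.setReg hi.2).setReg (by decide)
  · intro k hk t ht htk hI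
    refine (hstep _ k hk t ht htk hI).mono le_rfl fun u _ hu => ?_
    refine (((hu.setReg (by decide)).setReg hi.2).setReg (by decide)).mono ?_
    rintro R (hR | ⟨l, hl, hR⟩)
    · exact .inl (.inl hR)
    · rcases Nat.lt_succ_iff_lt_or_eq.1 hl with hl | rfl
      · exact .inl (.inr ⟨l, hl, hR⟩)
      · exact .inr hR

/-- The pool of rows among which the best one is chosen. -/
def pool (n : ℕ) : Set (ℕ → ℕ) :=
  {R | ∃ Q < 2 * n + 1, ∃ B < 2 * n + 1, ∃ a < 2 * n + 1, ∃ b < 2 * n + 1, R = poolRow Q B a b}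

/-- A bound for the time of the search for the best row. -/
def searchTime (n E : ℕ) : ℕ :=
  (E * 31 + 4) + ((n * 6 + 5) + ((2 * n + 1) * ((2 * n + 1) * ((2 * n + 1) * ((2 * n + 1) *
    (n * 20 + E * 31 + 16 + 4) + 3 + 4) + 3 + 4) + 3 + 4) + 3))

theorem reach_bestRow (hL : ∀ e < L.length, (evAt L e).2 ⊆ (evAt L e).1 ∧
      (evAt L e).1 ⊆ range n ∧ (evAt L e).1.card ≤ p)
    {s : State} (hT : EventTable L s) (hn : s.reg rN = n) (hb : s.reg rL = 2 * n + 1)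
    (hA : s.arr aLive = A) (hw : ∀ j ≤ p, s.arr aW (s.reg rBase + j) = w j)
    (hS : s.arr aS 0 = 0) (hC : s.arr aC 0 = 0) (hR : ∀ x < n, s.arr aRow x ≤ 1) :
    Reach bestRow s (searchTime n L.length) (BestInv n p L A w (pool n)) := by
  refine (reach_evalRow hT hS hC).then ?_
  rintro t ht ⟨htSum, -, htS, htC⟩
  rw [hA, weight_congr hL (fun _ _ => rfl) (fun _ _ => rfl) hw] at htSum
  refine (reach_copyBest (by rw [ht.1 _ (by decide), hn])).then ?_
  rintro u hu ⟨h1, h2⟩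
  have htu : Agree (evalRow ;; copyBest) s u :=
    (ht.mono (by decide) (by decide)).trans (hu.mono (by decide) (by decide))
  have hrow : ∀ x < n, u.arr aBest x = s.arr aRow x := fun x hx => by
    rw [h2 x hx, ht.2 _ (by decide)]
  have huI : BestInv n p L A w ∅ u :=
    { table := hT.agree htu (by decide)
      cols := by rw [htu.1 _ (by decide), hn]
      bound := by rw [htu.1 _ (by decide), hb]
      alive := by rw [htu.2 _ (by decide), hA]
      weights := by rw [htu.2 aW (by decide), htu.1 rBase (by decide)]; exact hw
      zeroS := by rw [hu.2 _ (by decide), htS]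
      zeroC := by rw [hu.2 _ (by decide), htC]
      row_le := by rw [htu.2 _ (by decide)]; exact hR
      best_le := fun x hx => by rw [hrow x hx]; exact hR x hx
      best := by
        rw [h1, htSum]
        exact (weight_congr hL (fun _ _ => rfl) hrow fun _ _ => rfl).symm
      min := by simp }
  refine (reach_poolLoop (D := fun Q => {R | ∃ B < 2 * n + 1, ∃ a < 2 * n + 1, ∃ b < 2 * n + 1,
      R = poolRow Q B a b}) (by decide) huI ?_).mono le_rfl
    fun _ _ h => h.mono Set.subset_union_right
  intro C Q hQ u₁ _ hu₁ hI₁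
  refine reach_poolLoop (D := fun B => {R | ∃ a < 2 * n + 1, ∃ b < 2 * n + 1,
      R = poolRow Q B a b}) (by decide) hI₁ ?_
  intro C B hB u₂ ha₂ hu₂ hI₂
  refine reach_poolLoop (D := fun a => {R | ∃ b < 2 * n + 1, R = poolRow Q B a b})
    (by decide) hI₂ ?_
  intro C a ha u₃ ha₃ hu₃ hI₃
  refine reach_poolLoop (D := fun b => {poolRow Q B a b}) (by decide) hI₃ ?_
  intro C b hb u₄ ha₄ hu₄ hI₄
  refine reach_tryRow hL hI₄ ?_ ?_ ?_ hu₄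
  · rw [ha₄.1 _ (by decide), ha₃.1 _ (by decide), ha₂.1 _ (by decide), hu₁]
  · rw [ha₄.1 _ (by decide), ha₃.1 _ (by decide), hu₂]
  · rw [ha₄.1 _ (by decide), hu₃]

theorem reach_takeBest {s : State} (hT : EventTable L s)
    (hL : ∀ e < L.length, (evAt L e).2 ⊆ (evAt L e).1 ∧
      (evAt L e).1 ⊆ range n ∧ (evAt L e).1.card ≤ p)
    (hn : s.reg rN = n) (hS : s.arr aS 0 = 0) (hC : s.arr aC 0 = 0) :
    Reach takeBest s (n * 9 + L.length * 37 + 10) fun t =>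
      t.reg rOut = s.reg rOut + n ∧
      (∀ x < n, t.arr aOut (s.reg rOut + x) = s.arr aBest x) ∧
      (∀ q < s.reg rOut, t.arr aOut q = s.arr aOut q) ∧
      (∀ x < n, t.arr aRow x = s.arr aBest x) ∧
      (∀ e < L.length, t.arr aLive e =
        if s.arr aLive e ≠ 0 ∧ ¬ Hit (s.arr aBest) (evAt L e) then 1 else 0) ∧
      t.arr aS 0 = 0 ∧ t.arr aC 0 = 0 := by
  rw [show n * 9 + L.length * 37 + 10 = (n * (5 + 4) + 3) + ((L.length * 31 + 4) +
    (L.length * (2 + 4) + 3)) by ring]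
  refine (Reach.forTo (fun k t => t.reg rOut = s.reg rOut + k ∧
      (∀ x < k, t.arr aOut (s.reg rOut + x) = s.arr aBest x) ∧
      (∀ q < s.reg rOut, t.arr aOut q = s.arr aOut q) ∧
      (∀ x < k, t.arr aRow x = s.arr aBest x)) hn (by decide) (by simp) ?_).then ?_
  · rintro k hk t ht htk ⟨h1, h2, h3, h4⟩
    have htB : t.arr aBest = s.arr aBest := ht.2 _ (by decide)
    refine .flat rfl (by decide) ?_
    simp only [eval, htk, htB, h1, State.setReg_reg, State.setArr_reg, State.setReg_arr,
      State.setArr_arr, if_true, Nat.reduceEqDiff, if_false, OfNat.ofNat_ne_zero,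
      OfNat.zero_ne_ofNat]
    refine ⟨by omega, fun x hx => ?_, fun q hq => ?_, fun x hx => ?_⟩
    · by_cases hxk : x = k
      · rw [hxk, Function.update_self]
      · rw [Function.update_of_ne (by omega)]; exact h2 x (by omega)
    · rw [Function.update_of_ne (by omega)]; exact h3 q hq
    · by_cases hxk : x = k
      · rw [hxk, Function.update_self]
      · rw [Function.update_of_ne hxk]; exact h4 x (by omega)
  · rintro t ht ⟨h1, h2, h3, h4⟩
    have hT' := hT.agree ht (by decide)
    refine (reach_evalRow hT' (by rw [ht.2 _ (by decide), hS])
      (by rw [ht.2 _ (by decide), hC])).then ?_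
    rintro u hu ⟨-, huN, huS, huC⟩
    have hnew : ∀ e < L.length, u.arr aNew e =
        if s.arr aLive e ≠ 0 ∧ ¬ Hit (s.arr aBest) (evAt L e) then 1 else 0 := by
      intro e he
      rw [huN e he, ht.2 aLive (by decide)]
      simp only [Hit.congr (hL e he).2.1 (hL e he).1 h4]
    refine (Reach.forTo (fun k t => ∀ e < k, t.arr aLive e =
        if s.arr aLive e ≠ 0 ∧ ¬ Hit (s.arr aBest) (evAt L e) then 1 else 0)
      (hT'.agree hu (by decide)).length (by decide) (by simp) ?_).mono le_rfl ?_
    · intro k hk z hz hzk hI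
      have hzN : z.arr aNew = u.arr aNew := hz.2 _ (by decide)
      refine .flat rfl (by decide) ?_
      simp only [eval, hzk, hzN, State.setReg_reg, State.setReg_arr, State.setArr_arr, if_true,
        Nat.reduceEqDiff, if_false]
      intro e he
      by_cases hek : e = k
      · rw [hek, Function.update_self, hnew k hk]
      · rw [Function.update_of_ne hek]; exact hI e (by omega)
    · intro z hz hI
      refine ⟨?_, ?_, ?_, ?_, hI, ?_, ?_⟩
      · rw [hz.1 _ (by decide), hu.1 _ (by decide), h1]
      · rw [hz.2 _ (by decide), hu.2 _ (by decide)]; exact h2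
      · rw [hz.2 _ (by decide), hu.2 _ (by decide)]; exact h3
      · rw [hz.2 _ (by decide), hu.2 _ (by decide)]; exact h4
      · rw [hz.2 _ (by decide), huS]
      · rw [hz.2 _ (by decide), huC]

end

/-- The invariant of the greedy choice of `m` rows, after `t` rows: the rows `R 0, …, R (t - 1)`
have been written, the events marked as alive are those with mark `A₀` that none of them hits, and
the total weight has dropped by a factor of at least `Y` with each row. -/
structure GreedyInv (n p Y m : ℕ) (L : List Event) (X A₀ : ℕ → ℕ) (t : ℕ) (R : ℕ → ℕ → ℕ)
    (s : State) : Prop where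
  table : EventTable L s
  base : s.reg rBase = (m - t) * (p + 1)
  out : s.reg rOut = 1 + t * n
  size : s.arr aOut 0 = m
  rows : ∀ i < t, ∀ x < n, s.arr aOut (1 + i * n + x) = R i x
  rows_le : ∀ i < t, ∀ x < n, R i x ≤ 1
  alive : ∀ e < L.length, s.arr aLive e ≠ 0 ↔ A₀ e ≠ 0 ∧ ∀ i < t, ¬ Hit (R i) (evAt L e)
  weight_le : Y ^ t * weight L (s.arr aLive) (fun _ => 0) (fun j => X j ^ (m - t)) ≤
    weight L A₀ (fun _ => 0) (fun j => X j ^ m)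
  row_le : ∀ x < n, s.arr aRow x ≤ 1
  zeroS : s.arr aS 0 = 0
  zeroC : s.arr aC 0 = 0

set_option maxRecDepth 4000 in
theorem reach_greedy {n p Y m : ℕ} {L : List Event} {X : ℕ → ℕ} {s : State}
    (hL : ∀ e < L.length, (evAt L e).2 ⊆ (evAt L e).1 ∧
      (evAt L e).1 ⊆ range n ∧ (evAt L e).1.card ≤ p)
    (hT : EventTable L s) (hn : s.reg rN = n) (hb : s.reg rL = 2 * n + 1)
    (hp : s.reg rP1 = p + 1) (hP : PowerTable p Y X m s)
    (hS : s.arr aS 0 = 0) (hC : s.arr aC 0 = 0) (hR : ∀ x < n, s.arr aRow x = 0)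
    (hpool : ∀ A : ℕ → ℕ, (∀ e < L.length, A e ≠ 0 → s.arr aLive e ≠ 0) → ∀ r, ∃ R ∈ pool n,
      Y * weight L A R (fun j => X j ^ r) ≤ weight L A (fun _ => 0) (fun j => X j ^ (r + 1))) :
    Reach greedy s (m * (searchTime n L.length + (n * 9 + L.length * 37 + 10) + 5) + 6) fun t =>
      ∃ R, GreedyInv n p Y m L X (s.arr aLive) m R t := by
  rw [show m * (searchTime n L.length + (n * 9 + L.length * 37 + 10) + 5) + 6 = 1 + (1 + (1 + (m *
    ((1 + (searchTime n L.length + (n * 9 + L.length * 37 + 10))) + 4) + 3))) by ring]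
  refine .seq (.flat rfl le_rfl (.seq (.flat rfl le_rfl (.seq (.flat rfl le_rfl ?_)))))
  set s' := eval (.store aOut 0 rM) _
  have hs' : Agree (.const rOut 1 ;; .const 0 0 ;; .store aOut 0 rM) s s' := by
    have : Reach (.const rOut 1 ;; .const 0 0 ;; .store aOut 0 rM) s 3 (fun t => t = s') :=
      .flat rfl (by decide) rfl
    obtain ⟨t, k, he, -, rfl⟩ := this
    exact he.agree
  have hs'm : s'.reg rM = m := by rw [hs'.1 _ (by decide), hP.size]
  refine (Reach.forTo (fun t u => ∃ R, GreedyInv n p Y m L X (s.arr aLive) t R u) hs'm (by decide)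
    ?_ ?_)
  · refine ⟨fun _ _ => 0, ?_⟩
    have hT' := hT.agree hs' (by decide)
    constructor
    · exact hT'.congr (by simp) (by simp)
    · simp only [State.setReg_reg, Nat.reduceEqDiff, if_false]
      rw [hs'.1 _ (by decide), hP.base, Nat.sub_zero]
    · simp [s', eval]
    · simp [s', eval, hP.size]
    · simp
    · simp
    · simp [hs'.2 aLive (by decide)]
    · simp [hs'.2 aLive (by decide)]
    · simp only [State.setReg_arr]
      rw [hs'.2 aRow (by decide)]; intro x hx; rw [hR x hx]; omega
    · simp [hs'.2 aS (by decide), hS]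
    · simp [hs'.2 aC (by decide), hC]
  · rintro t ht u hu hut ⟨R, hG⟩
    have hsu : Agree greedy s u :=
      (hs'.mono (by decide) (by decide)).trans (hu.mono (by decide) (by decide))
    have hun : u.reg rN = n := by rw [hsu.1 _ (by decide), hn]
    have hub : u.reg rL = 2 * n + 1 := by rw [hsu.1 _ (by decide), hb]
    have hup : u.reg rP1 = p + 1 := by rw [hsu.1 _ (by decide), hp]
    have huW : u.arr aW = s.arr aW := hsu.2 _ (by decide)
    obtain ⟨r, hr⟩ : ∃ r, m - t = r + 1 := ⟨m - t - 1, by omega⟩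
    have hr' : m - (t + 1) = r := by omega
    set A := u.arr aLive with hA
    have hbase : u.reg rBase - u.reg rP1 = r * (p + 1) := by
      rw [hG.base, hup, hr, Nat.succ_mul]; omega
    refine .seq (.flat rfl le_rfl ?_)
    simp only [eval, hbase]
    refine (reach_bestRow (A := A) (w := fun j => X j ^ r) (n := n) (p := p) hL
      (hG.table.congr (by simp) (by simp)) (by simp [hun]) (by simp [hub]) (by simp [hA]) ?_
      (by simp [hG.zeroS]) (by simp [hG.zeroC]) (by simpa using hG.row_le)).then ?_
    · intro j hj
      simp only [State.setReg_reg, State.setReg_arr, if_true, huW]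
      exact hP.table r (by omega) j hj
    intro z hz hB
    refine (reach_takeBest hB.table hL hB.cols hB.zeroS hB.zeroC).mono le_rfl ?_
    rintro y hy ⟨y1, y2, y3, y4, y5, y6, y7⟩
    have hzout : z.reg rOut = 1 + t * n := by
      rw [hz.1 _ (by decide)]; simp [hG.out]
    have hzarr : z.arr aOut = u.arr aOut := by
      rw [hz.2 _ (by decide)]; simp
    rw [hzout] at y1 y2 y3
    rw [hzarr] at y3
    simp only [hB.alive] at y5
    refine ⟨Function.update R t (z.arr aBest), ?_⟩
    constructor
    · exact (hB.table.agree hy (by decide)).congr (by simp) (by simp)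
    · simp only [State.setReg_reg, Nat.reduceEqDiff, if_false]
      rw [hy.1 _ (by decide), hz.1 _ (by decide), hr']
      simp
    · simp only [State.setReg_reg, Nat.reduceEqDiff, if_false]
      rw [y1]; ring
    · simp only [State.setReg_arr]
      rw [y3 0 (by omega), hG.size]
    · intro i hi x hx
      simp only [State.setReg_arr]
      rcases Nat.lt_succ_iff_lt_or_eq.1 hi with hi | rfl
      · rw [Function.update_of_ne hi.ne, y3, hG.rows i hi x hx]
        have : i * n + x < t * n := by
          calc i * n + x < (i + 1) * n := by rw [Nat.succ_mul]; omega
            _ ≤ t * n := Nat.mul_le_mul_right _ hi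
        omega
      · rw [Function.update_self, y2 x hx]
    · intro i hi x hx
      rcases Nat.lt_succ_iff_lt_or_eq.1 hi with hi | rfl
      · rw [Function.update_of_ne hi.ne]; exact hG.rows_le i hi x hx
      · rw [Function.update_self]; exact hB.best_le x hx
    · intro e he
      simp only [State.setReg_arr]
      rw [y5 e he]
      have h1 := hG.alive e he
      constructor
      · intro h
        have h2 : A e ≠ 0 ∧ ¬ Hit (z.arr aBest) (evAt L e) := by
          by_contra hc; exact h (if_neg hc)
        obtain ⟨h3, h4⟩ := h1.1 h2.1
        refine ⟨h3, fun i hi => ?_⟩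
        rcases Nat.lt_succ_iff_lt_or_eq.1 hi with hi | rfl
        · rw [Function.update_of_ne hi.ne]; exact h4 i hi
        · rw [Function.update_self]; exact h2.2
      · rintro ⟨h2, h3⟩
        rw [if_pos]
        · exact one_ne_zero
        · refine ⟨h1.2 ⟨h2, fun i hi => ?_⟩, ?_⟩
          · have := h3 i (by omega)
            rwa [Function.update_of_ne hi.ne] at this
          · have := h3 t (by omega)
            rwa [Function.update_self] at this
    · simp only [State.setReg_arr]
      rw [hr']
      have hnew : weight L (y.arr aLive) (fun _ => 0) (fun j => X j ^ r) =
          weight L A (z.arr aBest) (fun j => X j ^ r) := by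
        refine sum_congr rfl fun e he => ?_
        rw [y5 e (mem_range.1 he)]
        have hnz := not_hit_zero (evAt L e)
        by_cases h : A e ≠ 0 ∧ ¬ Hit (z.arr aBest) (evAt L e)
        · rw [if_pos h, if_pos h, if_pos ⟨one_ne_zero, hnz⟩]
        · rw [if_neg h, if_neg h, if_neg (by simp)]
      obtain ⟨R', hR', hle⟩ := hpool A (fun e he h => ((hG.alive e he).1 h).1) r
      have hmin := hB.min R' hR'
      rw [hB.best] at hmin
      have hwl := hG.weight_le
      rw [hr] at hwl
      rw [hnew]
      calc Y ^ (t + 1) * weight L A (z.arr aBest) (fun j => X j ^ r)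
          ≤ Y ^ (t + 1) * weight L A R' (fun j => X j ^ r) := Nat.mul_le_mul_left _ hmin
        _ = Y ^ t * (Y * weight L A R' (fun j => X j ^ r)) := by ring
        _ ≤ Y ^ t * weight L A (fun _ => 0) (fun j => X j ^ (r + 1)) := Nat.mul_le_mul_left _ hle
        _ ≤ _ := hwl
    · intro x hx
      simp only [State.setReg_arr]
      rw [y4 x hx]; exact hB.best_le x hx
    · simp only [State.setReg_arr]; exact y6
    · simp only [State.setReg_arr]; exact y7

end RAM

/-! ### Running time and conclusion -/

namespace RAM
open Prog

theorem poly_step {n a c u : ℕ} (k : ℕ) (hn : 1 ≤ n) (hu : 1 ≤ u) (h : a ≤ c * u) :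
    (2 * n + 1) * a + k ≤ (3 * c + k) * (u * n) := by
  have h1 : 1 ≤ u * n := Nat.one_le_iff_ne_zero.2 (Nat.mul_ne_zero (by omega) (by omega))
  calc (2 * n + 1) * a + k ≤ (3 * n) * (c * u) + k * (u * n) :=
        Nat.add_le_add (Nat.mul_le_mul (by omega) h) (Nat.le_mul_of_pos_right _ h1)
    _ = _ := by ring

theorem searchTime_le {n E Z : ℕ} (hn : 1 ≤ n) (hZ : 1 ≤ Z) (hE : E ≤ Z) :
    searchTime n E ≤ 6073 * (Z * n ^ 5) := by
  have hpow : ∀ k, 1 ≤ n ^ k := fun k => Nat.one_le_pow _ _ hn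
  have hpos : ∀ k, 1 ≤ Z * n ^ k := fun k => Nat.mul_pos hZ (hpow k)
  have hu : ∀ k, Z * n ^ k * n = Z * n ^ (k + 1) := fun k => by ring
  have e1 : n ≤ Z * n ^ 1 := by rw [pow_one]; exact Nat.le_mul_of_pos_left _ hZ
  have e2 : E ≤ Z * n ^ 1 := hE.trans (Nat.le_mul_of_pos_right _ (hpow 1))
  have a1 : n * 20 + E * 31 + 16 + 4 ≤ 71 * (Z * n ^ 1) := by have := hpos 1; omega
  have a2 := poly_step 7 hn (hpos 1) a1
  have a3 := poly_step 7 hn (hpos 2) (a2.trans_eq (by rw [hu 1]))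
  have a4 := poly_step 7 hn (hpos 3) (a3.trans_eq (by rw [hu 2]))
  have a5 := poly_step 3 hn (hpos 4) (a4.trans_eq (by rw [hu 3]))
  rw [hu 4] at a5
  have e3 : Z * n ^ 1 ≤ Z * n ^ 5 := Nat.mul_le_mul_left _ (Nat.pow_le_pow_right hn (by norm_num))
  have := hpos 5
  unfold searchTime
  simp only [add_assoc] at a5 ⊢
  norm_num at a5 ⊢
  omega

/-- A bound for the time that the program takes if it writes `m` rows. -/
def totalTime (n p E Y m : ℕ) : ℕ :=
  7 + (1 + (1 + ((((p + 1) * 9 + 6) + (((p + 1) * (p * 5 + 14) + 3) +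
    (((p + 1) * ((p + 1) * 5 + 17) + p * 5 + 11) + ((n * (E * 31 + 9) + 4) + ((E * 13 + 3) +
    ((m * ((p + 1) * (Y * 5 + 13) + Y * 5 + E * 31 + 20) + E * 31 + 9) +
    (m * (searchTime n E + (n * 9 + E * 37 + 10) + 5) + 6))))))) + 1)))

theorem totalTime_le {n p E Y m : ℕ} (hn : 2 ≤ n) (hp : p + 1 ≤ n)
    (hE : E ≤ 4 ^ p * n ^ p) (hY : Y ≤ 16 * n ^ 2) (hm : m ≤ 726 * n ^ 3) :
    totalTime n p E Y m ≤ 40 ^ p * n ^ (p + 40) := by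
  have hn1 : 1 ≤ n := by omega
  set Z := 4 ^ p * n ^ p with hZdef
  have hZ : 1 ≤ Z := Nat.mul_pos (by positivity) (by positivity)
  have hpow : ∀ k, 1 ≤ n ^ k := fun k => Nat.one_le_pow _ _ hn1
  have hpos : ∀ k, 1 ≤ Z * n ^ k := fun k => Nat.mul_pos hZ (hpow k)
  have hs := searchTime_le hn1 hZ hE
  have mono : ∀ k ≤ 8, Z * n ^ k ≤ Z * n ^ 8 := fun k hk =>
    Nat.mul_le_mul_left _ (Nat.pow_le_pow_right hn1 hk)
  have lift : ∀ k ≤ 8, n ^ k ≤ Z * n ^ 8 := fun k hk =>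
    (Nat.le_mul_of_pos_left _ hZ).trans (mono k hk)
  have hone := hpos 8
  have hnU : n ≤ Z * n ^ 8 := by simpa using lift 1 (by norm_num)
  have hEU : E ≤ Z * n ^ 8 := hE.trans (by simpa using mono 0 (by norm_num))
  have b1 : (p + 1) * (p * 5 + 14) ≤ 19 * (Z * n ^ 8) := by
    calc (p + 1) * (p * 5 + 14) ≤ n * (n * 5 + 14 * n) := by gcongr <;> omega
      _ = 19 * n ^ 2 := by ring
      _ ≤ _ := Nat.mul_le_mul_left _ (lift 2 (by norm_num))
  have b2 : (p + 1) * ((p + 1) * 5 + 17) ≤ 22 * (Z * n ^ 8) := by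
    calc (p + 1) * ((p + 1) * 5 + 17) ≤ n * (n * 5 + 17 * n) := by gcongr; omega
      _ = 22 * n ^ 2 := by ring
      _ ≤ _ := Nat.mul_le_mul_left _ (lift 2 (by norm_num))
  have b3 : n * (E * 31 + 9) ≤ 40 * (Z * n ^ 8) := by
    calc n * (E * 31 + 9) ≤ n * (Z * 31 + 9 * Z) := by gcongr; omega
      _ = 40 * (Z * n ^ 1) := by ring
      _ ≤ _ := Nat.mul_le_mul_left _ (mono 1 (by norm_num))
  have b4 : m * ((p + 1) * (Y * 5 + 13) + Y * 5 + E * 31 + 20) ≤ 163350 * (Z * n ^ 8) := by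
    have c1 : (p + 1) * (Y * 5 + 13) ≤ 93 * (Z * n ^ 3) := by
      calc (p + 1) * (Y * 5 + 13) ≤ n * (16 * n ^ 2 * 5 + 13 * n ^ 2) := by
            gcongr
            exact Nat.le_mul_of_pos_right _ (hpow 2)
        _ = 93 * n ^ 3 := by ring
        _ ≤ _ := Nat.mul_le_mul_left _ (Nat.le_mul_of_pos_left _ hZ)
    have c2 : n ^ 2 ≤ Z * n ^ 3 := (Nat.pow_le_pow_right hn1 (by norm_num)).trans
      (Nat.le_mul_of_pos_left _ hZ)
    have c3 : E ≤ Z * n ^ 3 := hE.trans (Nat.le_mul_of_pos_right _ (hpow 3))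
    have c4 := hpos 3
    have c5 : (p + 1) * (Y * 5 + 13) + Y * 5 + E * 31 + 20 ≤ 225 * (Z * n ^ 3) := by omega
    calc _ ≤ 726 * n ^ 3 * (225 * (Z * n ^ 3)) := Nat.mul_le_mul hm c5
      _ = 163350 * (Z * n ^ 6) := by ring
      _ ≤ _ := Nat.mul_le_mul_left _ (mono 6 (by norm_num))
  have b5 : m * (searchTime n E + (n * 9 + E * 37 + 10) + 5) ≤ 4453284 * (Z * n ^ 8) := by
    have c2 : n ≤ Z * n ^ 5 := (Nat.le_self_pow (by norm_num) n).trans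
      (Nat.le_mul_of_pos_left _ hZ)
    have c3 : E ≤ Z * n ^ 5 := hE.trans (Nat.le_mul_of_pos_right _ (hpow 5))
    have c4 := hpos 5
    have c5 : searchTime n E + (n * 9 + E * 37 + 10) + 5 ≤ 6134 * (Z * n ^ 5) := by omega
    calc _ ≤ 726 * n ^ 3 * (6134 * (Z * n ^ 5)) := Nat.mul_le_mul hm c5
      _ = 4453284 * (Z * n ^ 8) := by ring
      _ ≤ _ := le_rfl
  have htot : totalTime n p E Y m ≤ 2 ^ 23 * (Z * n ^ 8) := by
    unfold totalTime
    omega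
  calc totalTime n p E Y m ≤ 2 ^ 23 * (Z * n ^ 8) := htot
    _ ≤ n ^ 23 * (Z * n ^ 8) := by gcongr
    _ = 4 ^ p * n ^ (p + 31) := by rw [hZdef]; ring
    _ ≤ 40 ^ p * n ^ (p + 40) := by
      gcongr
      · norm_num
      · norm_num

theorem exists_pivot {p : ℕ} (hp : 1 ≤ p) (v : ℕ → ℕ) :
    ∃ g, 1 ≤ g ∧ g ≤ p ∧ g * threshold v g ≤ 2 * p ∧
      ∀ j ≤ p, g < j → 2 * p < j * threshold v j := by
  classical
  have h1 : 1 * threshold v 1 ≤ 2 * p := by have := threshold_le v 1; omega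
  refine ⟨Nat.findGreatest (fun j => j * threshold v j ≤ 2 * p) p, Nat.le_findGreatest hp h1,
    Nat.findGreatest_le p,
    Nat.findGreatest_spec (P := fun j => j * threshold v j ≤ 2 * p) hp h1, fun j hj hlt => ?_⟩
  have := Nat.findGreatest_is_greatest hlt hj
  omega

/-- The initial total weight of the relevant events, sorted by cardinality. -/
theorem weight_eventList_le {p n : ℕ} {v : ℕ → ℕ} (A w : ℕ → ℕ)
    (hA : ∀ e < (eventList p n).length, A e =
      if (evAt (eventList p n) e).2.card = threshold v (evAt (eventList p n) e).1.card
      then 1 else 0) :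
    weight (eventList p n) A (fun _ => 0) w ≤
      ∑ j ∈ range (p + 1), n.choose j * 2 ^ j * if j = 0 then 0 else w j := by
  rw [← sum_map_eventList p n fun j => if j = 0 then 0 else w j,
    ← sum_range_getD (eventList p n) (∅, ∅) fun e => if e.1.card = 0 then 0 else w e.1.card]
  refine sum_le_sum fun e he => ?_
  rw [mem_range] at he
  change _ ≤ if (evAt (eventList p n) e).1.card = 0 then 0 else w (evAt (eventList p n) e).1.card
  by_cases h0 : (evAt (eventList p n) e).1.card = 0
  · have h1 := card_le_card (mem_eventList (evAt_mem he)).1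
    rw [hA e he, h0, if_neg (show (evAt (eventList p n) e).2.card ≠ threshold v 0 by
      rw [threshold, if_pos rfl]; omega)]
    simp
  · rw [if_neg h0]
    split_ifs
    · exact le_rfl
    · exact Nat.zero_le _

/-- At the end no event is alive, since the total weight has dropped below `1`; so the rows form a
superselector. -/
theorem GreedyInv.isSuperselector {n p Y m : ℕ} {v X A₀ : ℕ → ℕ} {R : ℕ → ℕ → ℕ} {t : State}
    (h : GreedyInv n p Y m (eventList p n) X A₀ m R t)
    (hA : ∀ e < (eventList p n).length, A₀ e =
      if (evAt (eventList p n) e).2.card = threshold v (evAt (eventList p n) e).1.card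
      then 1 else 0)
    (hm : weight (eventList p n) A₀ (fun _ => 0) (fun j => X j ^ m) < Y ^ m) :
    IsSuperselector p v (fun (r : Fin m) (c : Fin n) => decide (R r c = 1)) := by
  refine isSuperselector_of_hit R h.rows_le fun S T hTS hS hc hT => ?_
  have hmem : (S, T) ∈ eventList p n := mem_eventList_of_subset hTS hS hc
  obtain ⟨e, he, heq⟩ := List.getElem_of_mem hmem
  have hev : evAt (eventList p n) e = (S, T) := by
    simp [evAt, List.getD, List.getElem?_eq_getElem he, heq]
  have hw0 : weight (eventList p n) (t.arr aLive) (fun _ => 0) (fun j => X j ^ (m - m)) = 0 := by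
    have := h.weight_le.trans_lt hm
    by_contra hne
    exact absurd this (not_lt.2 (Nat.le_mul_of_pos_right _ (Nat.pos_of_ne_zero hne)))
  have hdead : t.arr aLive e = 0 := by
    have := (sum_eq_zero_iff.1 hw0) e (mem_range.2 he)
    by_contra hne
    rw [if_pos ⟨hne, not_hit_zero _⟩] at this
    simp at this
  by_contra! hcon
  refine (h.alive e he).2 ⟨?_, fun i hi => ?_⟩ hdead
  · rw [hA e he, hev, if_pos hT]; exact one_ne_zero
  · rw [hev]; exact hcon i hi

theorem GreedyInv.outputs {n p Y m : ℕ} {L : List Event} {X A₀ : ℕ → ℕ} {R : ℕ → ℕ → ℕ}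
    {t : State} (h : GreedyInv n p Y m L X A₀ m R t) :
    Outputs t (fun (r : Fin m) (c : Fin n) => decide (R r c = 1)) := by
  refine ⟨h.size, fun r c => ?_⟩
  rw [h.rows r r.2 c c.2]
  have := h.rows_le r r.2 c c.2
  by_cases h1 : R r c = 1
  · simp [h1]
  · simp [h1]; omega

theorem input_arr {n p : ℕ} {v : ℕ → ℕ} {b : ℕ} (hb : b ≠ 0) (i : ℕ) :
    (input n p v).arr b i = 0 := by simp [input, hb]

set_option maxRecDepth 10000 in
/-- The run of the program in the case `2 p ≤ n`, in which the rows are chosen greedily. -/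
theorem reach_superselector {n p : ℕ} {v : ℕ → ℕ} (hp : 1 ≤ p) (hpn : 2 * p ≤ n)
    (hv : ∀ i, 1 ≤ i → i ≤ p → v i ≤ i) :
    ∃ g ≤ p, ∃ m : ℕ, (m : ℝ) ≤ 242 * superBound n p v hp ∧
      Reach superselector (input n p v)
        (totalTime n p (eventList p n).length (16 * (p * g)) m) fun t =>
        ∃ M : Matrix (Fin m) (Fin n) Bool, IsSuperselector p v M ∧ Outputs t M := by
  classical
  obtain ⟨g, hg1, hgp, hgT, hgj⟩ := exists_pivot hp v
  have hL : ∀ e < (eventList p n).length, (evAt (eventList p n) e).2 ⊆ (evAt (eventList p n) e).1 ∧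
      (evAt (eventList p n) e).1 ⊆ range n ∧ (evAt (eventList p n) e).1.card ≤ p :=
    fun e he => mem_eventList (evAt_mem he)
  set L := eventList p n
  let X : ℕ → ℕ := fun j => 16 * (p * g) - threshold v j * if j ≤ g then p else g
  let A₀ : ℕ → ℕ := fun e => if (evAt L e).2.card = threshold v (evAt L e).1.card then 1 else 0
  obtain ⟨m₁, hm₁, hm₁b⟩ := exists_size hp hpn hv hg1 hgp hgT hgj
  have hex : ∃ m, weight L A₀ (fun _ => 0) (fun j => X j ^ m) < (16 * (p * g)) ^ m :=
    ⟨m₁, (weight_eventList_le A₀ _ fun _ _ => rfl).trans_lt hm₁⟩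
  refine ⟨g, hgp, Nat.find hex,
    le_trans (by exact_mod_cast Nat.find_min' hex ((weight_eventList_le A₀ _
      fun _ _ => rfl).trans_lt hm₁)) hm₁b, ?_⟩
  have hm := Nat.find_spec hex
  have hmin : ∀ k < Nat.find hex, (16 * (p * g)) ^ k ≤
      weight L A₀ (fun _ => 0) (fun j => X j ^ k) := fun k hk => not_lt.1 (Nat.find_min hex hk)
  generalize Nat.find hex = m at hm hmin
  refine reach_readInput.then ?_
  rintro t₁ ht₁ ⟨h1n, h1p, h1p1, h1L⟩
  refine .seq (.flat rfl le_rfl (.seq (.flat rfl le_rfl (.branch (fun h0 => ?_) fun _ => ?_))))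
  · simp [eval, h1n, h1p] at h0; omega
  set u := eval (.sub rU rU rN) (eval (.add rU rP rP) t₁)
  have hu : Agree (readInput ;; .add rU rP rP ;; .sub rU rU rN) (input n p v) u := by
    have : Reach (.add rU rP rP ;; .sub rU rU rN) t₁ 2 fun t => t = u := .flat rfl (by decide) rfl
    obtain ⟨t, k, he, -, rfl⟩ := this
    exact (ht₁.mono (by decide) (by decide)).trans (he.agree.mono (by decide) (by decide))
  have un : u.reg rN = n := by simp [u, eval, h1n]
  have up : u.reg rP = p := by simp [u, eval, h1p]
  have up1 : u.reg rP1 = p + 1 := by simp [u, eval, h1p1]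
  have uL : u.reg rL = 2 * n + 1 := by simp [u, eval, h1L]
  refine (reach_thresholds (v := v) up1 ?_).then ?_
  · intro j hj hjp
    rw [hu.2 _ (by decide)]
    simp [input, show j ≠ 0 by omega, show j ≤ p by omega]
  intro t₂ ht₂ hT₂
  refine (reach_findPivot (τ := threshold v) (by rw [ht₂.1 _ (by decide), up])
    (by rw [ht₂.1 _ (by decide), up1]) hT₂).then ?_
  rintro t₃ ht₃ ⟨hg₁, hg₂, hg₃⟩
  have hG : t₃.reg rG = g := by
    rcases lt_trichotomy (t₃.reg rG) g with hlt | heq | hlt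
    · have := hg₃ g hgp hlt; omega
    · exact heq
    · have := hgj _ hg₁ hlt; omega
  have hu₃ : Agree (thresholds ;; findPivot) u t₃ :=
    (ht₂.mono (by decide) (by decide)).trans (ht₃.mono (by decide) (by decide))
  refine (reach_rates (τ := threshold v) (by rw [hu₃.1 _ (by decide), up]) hG
    (by rw [hu₃.1 _ (by decide), up1]) (by rw [ht₃.2 _ (by decide)]; exact hT₂)
    fun j _ => threshold_le v j).then ?_
  rintro t₄ ht₄ ⟨hY, hXW⟩
  have hu₄ : Agree (readInput ;; .add rU rP rP ;; .sub rU rU rN ;; thresholds ;; findPivot ;; rates)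
      (input n p v) t₄ :=
    (hu.mono (by decide) (by decide)).trans ((hu₃.mono (by decide) (by decide)).trans
      (ht₄.mono (by decide) (by decide)))
  have hn₄ : t₄.reg rN = n := by rw [ht₄.1 _ (by decide), hu₃.1 _ (by decide), un]
  refine (reach_listEvents (n := n) (p := p) hn₄
    (by rw [ht₄.1 _ (by decide), hu₃.1 _ (by decide), up])
    (by rw [hu₄.2 _ (by decide), input_arr (by decide)])
    (by rw [hu₄.2 _ (by decide), input_arr (by decide)])).then ?_
  intro t₅ ht₅ hET
  refine (reach_markRelevant (p := p) (τ := threshold v) hET (fun e he => (hL e he).2.2) ?_).then ?_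
  · rw [ht₅.2 _ (by decide), ht₄.2 _ (by decide), ht₃.2 _ (by decide)]
    exact hT₂
  intro t₆ ht₆ hA
  have hu₆ : Agree (listEvents ;; markRelevant) t₄ t₆ :=
    (ht₅.mono (by decide) (by decide)).trans (ht₆.mono (by decide) (by decide))
  have hET₆ := hET.agree ht₆ (by decide)
  have hp1₆ : t₆.reg rP1 = p + 1 := by
    rw [hu₆.1 _ (by decide), ht₄.1 _ (by decide), hu₃.1 _ (by decide), up1]
  have hR₆ : ∀ x < n, t₆.arr aRow x = 0 := fun x _ => by
    rw [hu₆.2 _ (by decide), hu₄.2 _ (by decide), input_arr (by decide)]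
  have hwt : ∀ w, weight L (t₆.arr aLive) (fun _ => 0) w = weight L A₀ (fun _ => 0) w :=
    fun w => weight_congr hL hA (fun _ _ => rfl) fun _ _ => rfl
  refine (reach_findSize (X := X) (Y := 16 * (p * g)) (m := m) hET₆ hL ?_ ?_ ?_ ?_ ?_ hR₆ hp1₆ ?_ ?_
    (fun j _ => Nat.sub_le _ _) (by rw [hwt]; exact hm) (fun k hk => by rw [hwt]; exact hmin k hk)
    ).then ?_
  · rw [hu₆.2 _ (by decide), hu₄.2 _ (by decide), input_arr (by decide)]
  · rw [hu₆.2 _ (by decide), hu₄.2 _ (by decide), input_arr (by decide)]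
  · rw [hu₆.1 _ (by decide), hu₄.1 _ (by decide)]; rfl
  · rw [hu₆.1 _ (by decide), hu₄.1 _ (by decide)]; rfl
  · rw [hu₆.2 _ (by decide)]; exact fun j hj => (hXW j hj).2
  · rw [hu₆.1 _ (by decide), hY]
  · rw [hu₆.2 _ (by decide)]; exact fun j hj => (hXW j hj).1
  rintro t₇ ht₇ ⟨hP, hS, hC⟩
  have hA₇ : t₇.arr aLive = t₆.arr aLive := ht₇.2 _ (by decide)
  refine (reach_greedy (X := X) (Y := 16 * (p * g)) hL (hET₆.agree ht₇ (by decide))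
    (by rw [ht₇.1 _ (by decide), hu₆.1 _ (by decide), hn₄])
    (by rw [ht₇.1 _ (by decide), hu₆.1 _ (by decide), ht₄.1 _ (by decide), hu₃.1 _ (by decide), uL])
    (by rw [ht₇.1 _ (by decide), hp1₆]) hP hS hC (by rw [ht₇.2 _ (by decide)]; exact hR₆)
    ?_).mono le_rfl ?_
  · intro A hAA r
    have hAτ : ∀ e < L.length, A e ≠ 0 → (evAt L e).2.card = threshold v (evAt L e).1.card := by
      intro e he hAe
      have h1 := hAA e he hAe
      rw [hA₇, hA e he] at h1
      by_contra hne
      exact h1 (if_neg hne)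
    obtain ⟨Q, hQ, B, hB, a, ha, b, hb, hle⟩ := exists_good_row (E := L.length) hg1 hgp hpn
      (threshold v) X (fun _ => rfl) (evAt L) hL A hAτ r
    refine ⟨_, ⟨Q, hQ, B, hB, a, ha, b, hb, rfl⟩, hle.trans_eq (sum_congr rfl fun e _ => ?_)⟩
    simp [not_hit_zero]
  · rintro t - ⟨R, hR⟩
    refine ⟨_, hR.isSuperselector (by rw [hA₇]; exact hA) ?_, hR.outputs⟩
    rw [hA₇, hwt]; exact hm

end RAM

theorem theorem1 :
    ∃ (prog : RAM.Prog) (K : ℝ) (C : ℕ),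
      ∀ (n p : ℕ) (v : ℕ → ℕ) (_ : 2 ≤ n) (hp : 1 ≤ p) (_ : p ≤ n)
        (_ : ∀ i : ℕ, 1 ≤ i → i ≤ p → v i ≤ i),
        ∃ (m : ℕ) (M : Matrix (Fin m) (Fin n) Bool) (t : RAM.State) (steps : ℕ),
          IsSuperselector p v M ∧
          (m : ℝ) ≤ K * superBound n p v hp ∧
          RAM.Exec prog (RAM.input n p v) t steps ∧
          RAM.Outputs t M ∧
          steps ≤ C ^ p * n ^ (p + C) := by
  refine ⟨RAM.superselector, 242, 40, fun n p v hn hp hpn hv => ?_⟩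
  by_cases h : 2 * p ≤ n
  · obtain ⟨g, hg, m, hm, t, k, he, hk, M, hM, hO⟩ := RAM.reach_superselector hp h hv
    refine ⟨m, M, t, k, hM, hm, he, hO, hk.trans ?_⟩
    refine RAM.totalTime_le hn (by omega) (length_eventList_le p (by omega)) ?_ ?_
    · calc 16 * (p * g) ≤ 16 * (n * n) := by gcongr; omega
        _ = 16 * n ^ 2 := by ring
    · have h1 := superBound_le hp hpn hv
      have : (m : ℝ) ≤ ((726 * n ^ 3 : ℕ) : ℝ) := by push_cast; linarith
      exact_mod_cast this
  · have hbound := card_le_superBound hn hp (by omega) hv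
    have hr : RAM.Reach RAM.superselector (RAM.input n p v) (n * (n * 12 + 7) + 16)
        fun t => t.arr 1 0 = n ∧
          ∀ r < n, ∀ c < n, t.arr 1 (1 + r * n + c) = if r = c then 1 else 0 := by
      rw [show n * (n * 12 + 7) + 16 = 7 + (1 + (1 + ((n * (n * 12 + 7) + 6) + 1))) by ring]
      refine RAM.reach_readInput.then ?_
      rintro t - ⟨h1, h2, -, -⟩
      refine .seq (.flat rfl le_rfl (.seq (.flat rfl le_rfl (.branch (fun _ => ?_) fun h0 => ?_))))
      · exact RAM.reach_writeIdentity (by simp [RAM.Prog.eval, h1])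
      · simp [RAM.Prog.eval, h1, h2] at h0; omega
    obtain ⟨t, k, he, hk, h1, h2⟩ := hr
    refine ⟨n, _, t, k, isSuperselector_identity hv, by nlinarith, he,
      ⟨h1, fun r c => ?_⟩, hk.trans ?_⟩
    · rw [h2 r r.2 c c.2]
      simp [Fin.ext_iff]
    · calc n * (n * 12 + 7) + 16 ≤ n * (n * 12 + 7 * n) + 16 * n ^ 2 := by
            gcongr
            · exact Nat.le_mul_of_pos_right _ (by omega)
            · exact Nat.le_mul_of_pos_right _ (by positivity)
        _ = 35 * n ^ 2 := by ring
        _ ≤ 2 ^ 6 * n ^ 2 := by gcongr; norm_num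
        _ ≤ n ^ 6 * n ^ 2 := by gcongr
        _ = 1 * n ^ 8 := by ring
        _ ≤ 40 ^ p * n ^ (p + 40) := by
          gcongr
          · exact Nat.one_le_pow _ _ (by norm_num)
          · omega
          · omega
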